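/- Let $(R,\mathfrak m)$ be a regular local domain with $\dim R\ge 2$ and field of fractions $K$. Let $\operatorname{ord}_R$ be the order valuation: for $0\neq x\in R$, $\operatorname{ord}_R(x)$ is the largest $n$ with $x\in\mathfrak m^n$. We identify $\operatorname{ord}_R$ with its valuation ring in $K$. For a nonzero proper ideal $J$ of a Noetherian normal domain $A$ with field of fractions $K$, let $\operatorname{Rees}J$ be the set of Rees valuation rings of $J$, that is, the discrete valuation rings $V$ of $K$ which are local rings of the normalized blow-up $\operatorname{Proj}\overline{A[Jt]}$ at points where $J$ extends to a proper ideal. Explicitly, $V=B_P$, where $0\ne a\in J$, $B$ is the integral closure of $A[J/a]$ in $K$, and $P$ is a prime of $B$ containing $a$. A point in the first neighborhood of $R$ is a regular local ring $S$ with $\dim S\ge2$ that is a local quadratic transform of $R$, i.e. $S$ is a local ring of the blow-up $\operatorname{Proj}R[\mathfrak m t]$ that dominates $R$. For an $\mathfrak m$-primary ideal $I$ of $R$ and such $S$, the transform of $I$ in $S$ is $I^{S}=c^{-1}IS$, where $cS$ is the smallest principal ideal of $S$ containing $IS$, and $S$ is a base point of $I$ if $I^{S}\neq S$. Let $I$ be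 an $\mathfrak m$-primary ideal of $R$ that has only finitely many base points $R_1,\dots,R_n$ (possibly none) in the first neighborhood of $R$. Then $$\{\operatorname{ord}_R\}\cup\operatorname{Rees}I=\{\operatorname{ord}_R\}\cup\bigcup_{i=1}^{n}\operatorname{Rees}I^{R_i},$$ and $$\operatorname{Rees}(\mathfrak mI)=\operatorname{Rees}\mathfrak m\cup\operatorname{Rees}I=\{\operatorname{ord}_R\}\cup\operatorname{Rees}I .$$ -/

import Mathlib

/-! Notions for a domain `A` inside a field `K` (in the applications, its field of fractions).
Local rings between `A` and `K` are `LocalSubring K`, ordered by domination; valuation rings of `K`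
are `ValuationSubring K`. -/

namespace QuadTransform

/-- The ring `A[J/a]`, generated over (the image of) `A` in `K` by all quotients `b / a` with
`b ∈ J`. For `0 ≠ a ∈ J` these are the affine charts of the blow-up of `J`. -/
def blowupChart (A K : Type*) [CommRing A] [Field K] [Algebra A K] (J : Ideal A) (a : A) :
    Subring K :=
  (Algebra.adjoin A {z : K | ∃ b ∈ J, z = algebraMap A K b / algebraMap A K a}).toSubring

/-- The integral closure of `A[J/a]` in `K`. For `0 ≠ a ∈ J` these are the affine charts of the
normalized blow-up of `J`; when `A` is normal with field of fractions `K`, that is the projective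
spectrum of the integral closure of the Rees algebra `A[Jt]`. -/
def normalizedBlowupChart (A K : Type*) [CommRing A] [Field K] [Algebra A K] (J : Ideal A)
    (a : A) : Subring K :=
  (integralClosure (blowupChart A K J a) K).toSubring

/-- The Rees valuation rings of `J`: the discrete valuation rings `V` of `K` that are local rings
of the normalized blow-up of `J` at points of the exceptional locus. On the chart belonging to `a`,
the extension of `J` is generated by `a`, so the latter means that the prime contains `a`. -/
def reesValuationRings (A K : Type*) [CommRing A] [Field K] [Algebra A K] (J : Ideal A) :
    Set (ValuationSubring K) :=
  {V | IsDiscreteValuationRing V ∧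
    ∃ a ∈ J, a ≠ 0 ∧
      ∃ (P : Ideal (normalizedBlowupChart A K J a)) (_ : P.IsPrime),
        (∃ z ∈ P, (z : K) = algebraMap A K a) ∧
        V.toSubring = (LocalSubring.ofPrime (normalizedBlowupChart A K J a) P).toSubring}

/-- The order of `x` with respect to the powers of the maximal ideal:
the supremum of all `n` with `x ∈ 𝔪 ^ n`. -/
noncomputable def order (A : Type*) [CommRing A] [IsLocalRing A] (x : A) : ℕ∞ :=
  ⨆ (n : ℕ) (_ : x ∈ IsLocalRing.maximalIdeal A ^ n), (n : ℕ∞)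

/-- `V` is the valuation ring of the order function of `A`: a fraction `x / y` belongs to `V` if
and only if the order of `x` is at least the order of `y`. -/
def IsOrderValuationRing (A K : Type*) [CommRing A] [IsLocalRing A] [Field K] [Algebra A K]
    (V : ValuationSubring K) : Prop :=
  ∀ x y : A, y ≠ 0 → (algebraMap A K x / algebraMap A K y ∈ V ↔ order A y ≤ order A x)

/-- There is at most one such valuation ring of the field of fractions. -/
theorem IsOrderValuationRing.unique {A K : Type*} [CommRing A] [IsLocalRing A] [IsDomain A]
    [Field K] [Algebra A K] [IsFractionRing A K] {V W : ValuationSubring K}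
    (hV : IsOrderValuationRing A K V) (hW : IsOrderValuationRing A K W) : V = W := by
  ext z
  obtain ⟨x, y, hy, rfl⟩ := IsFractionRing.div_surjective (A := A) z
  rw [hV x y (nonZeroDivisors.ne_zero hy), hW x y (nonZeroDivisors.ne_zero hy)]

/-- The extension `I S` of an ideal `I` of `A` to an overring `S` of `A` in `K`. -/
def extension {A K : Type*} [CommRing A] [Field K] [Algebra A K] (I : Ideal A) (S : Subring K) :
    Ideal S :=
  Ideal.span {s : S | ∃ r ∈ I, (s : K) = algebraMap A K r}

/-- The transform `c⁻¹ I S` of `I` in `S`, where `c S` is the smallest principal ideal of `S` that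
contains `I S`. As `I S ⊆ c S`, the elements of `c⁻¹ I S` are the `s ∈ S` with `s c ∈ I S`; this
does not depend on the generator `c`. -/
def transform {A K : Type*} [CommRing A] [Field K] [Algebra A K] (I : Ideal A) (S : Subring K) :
    Ideal S where
  carrier := {s : S | ∀ c : S,
    IsLeast {L : Ideal S | L.IsPrincipal ∧ extension I S ≤ L} (Ideal.span {c}) →
      s * c ∈ extension I S}
  zero_mem' := fun c _ => by
    rw [zero_mul]
    exact (extension I S).zero_mem
  add_mem' := fun {s t} hs ht c hc => by
    rw [add_mul]
    exact (extension I S).add_mem (hs c hc) (ht c hc)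
  smul_mem' := fun r s hs c hc => by
    rw [smul_eq_mul, mul_assoc]
    exact (extension I S).mul_mem_left r (hs c hc)

/-- `S` is a local quadratic transform of the local domain `R`: a local ring of the blow-up of the
maximal ideal of `R` that dominates `R`. -/
def IsLocalQuadraticTransform (R K : Type*) [CommRing R] [IsLocalRing R] [Field K] [Algebra R K]
    (S : LocalSubring K) : Prop :=
  LocalSubring.range (algebraMap R K) ≤ S ∧
    ∃ x ∈ IsLocalRing.maximalIdeal R, x ≠ 0 ∧
      ∃ (P : Ideal (blowupChart R K (IsLocalRing.maximalIdeal R) x)) (_ : P.IsPrime),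
        S = LocalSubring.ofPrime (blowupChart R K (IsLocalRing.maximalIdeal R) x) P

/-- The points in the first neighborhood of `R`: the regular local rings of dimension at least two
that are local quadratic transforms of `R`. -/
def firstNeighborhood (R K : Type*) [CommRing R] [IsLocalRing R] [Field K] [Algebra R K] :
    Set (LocalSubring K) :=
  {S | IsLocalQuadraticTransform R K S ∧ IsRegularLocalRing S.toSubring ∧
    2 ≤ ringKrullDim S.toSubring}

/-- The base points of `I` in the first neighborhood of `R`: the points there in which the
transform of `I` is a proper ideal. -/
def firstBasePoints {R : Type*} (K : Type*) [CommRing R] [IsLocalRing R] [Field K] [Algebra R K]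
    (I : Ideal R) : Set (LocalSubring K) :=
  {S | S ∈ firstNeighborhood R K ∧ transform I S.toSubring ≠ ⊤}

end QuadTransform

/-! Let `r` be the order of `I`. A Rees valuation ring of `J` is a discrete valuation ring `V` of
`K` that contains a chart `A[J/a]`, has `a` in its maximal ideal, and is the only subring of `V`
that contains `A[J/a]` and is saturated in `V`: integrally closed in `K`, with the inverses of all
its elements that are units of `V`. This criterion turns the blow-up of `𝔪 I` into a
condition on the two charts `R[𝔪/y]` and `R[I/a]` separately.

As the exceptional fibre of the blow-up of `𝔪` is a projective space, the local ring of its generic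
point is the order valuation ring `W`, and `Rees 𝔪 = {W}`. Now let `V ≠ W` be a Rees valuation ring
of `𝔪 I`, and `S` the local ring of the blow-up of `𝔪` at the center of `V`. The ideal `I S` is
`y ^ r I^S`, so that `V` is a Rees valuation ring of `I^S`, and `S` is a base point of `I`:
otherwise `S` itself would contain `R[I/a]`, and `V` would be `W`.

That `V` is a Rees valuation ring of `I` too needs the finiteness of the set of base points: the
transform of `I` then has only finitely many zeros on the exceptional fibre, hence the residue
field of `S` is algebraic over that of `R`, and by Zariski's main theorem the local ring of the
normalized blow-up of `I` at the center of `V` contains `S`. -/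

namespace QuadTransform

open IsLocalRing

/-! ### Regular systems of parameters -/

section LocalRing

variable {R : Type*} [CommRing R] [IsLocalRing R]

theorem isLocalRing_quotient {J : Ideal R} (hJ : J ≤ maximalIdeal R) : IsLocalRing (R ⧸ J) :=
  have : Nontrivial (R ⧸ J) := Ideal.Quotient.nontrivial_iff.mpr fun h =>
    (maximalIdeal.isMaximal R).ne_top (top_le_iff.mp (h ▸ hJ))
  .of_surjective' _ Ideal.Quotient.mk_surjective

theorem not_maximalIdeal_le_sq [IsNoetherianRing R] (hR : maximalIdeal R ≠ ⊥) :
    ¬ maximalIdeal R ≤ maximalIdeal R ^ 2 := fun h =>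
  ((Ideal.isIdempotentElem_iff_eq_bot_or_top_of_isLocalRing _).mp
    (le_antisymm Ideal.mul_le_left (pow_two (maximalIdeal R) ▸ h))).elim hR
    (maximalIdeal.isMaximal R).ne_top

theorem exists_mem_maximalIdeal_notMem_sq_notMem_minimalPrimes [IsNoetherianRing R]
    (hR : ringKrullDim R ≠ 0) :
    ∃ y ∈ maximalIdeal R, y ∉ maximalIdeal R ^ 2 ∧ ∀ p ∈ minimalPrimes R, y ∉ p := by
  by_contra! h
  have hht : (maximalIdeal R).height ≠ 0 := fun h0 =>
    hR (by rw [← maximalIdeal_height_eq_ringKrullDim, h0]; rfl)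
  have hcover : (maximalIdeal R : Set R) ⊆
      ⋃ J ∈ insert (maximalIdeal R ^ 2) (minimalPrimes R), ((id J : Ideal R) : Set R) := by
    intro y hy
    simp only [Set.mem_iUnion]
    by_cases hy2 : y ∈ maximalIdeal R ^ 2
    · exact ⟨_, Set.mem_insert _ _, hy2⟩
    · obtain ⟨p, hp, hyp⟩ := h y hy hy2
      exact ⟨p, Set.mem_insert_of_mem _ hp, hyp⟩
  obtain ⟨J, hJ, hle⟩ := (Ideal.subset_union_prime_finite
    ((minimalPrimes.finite_of_isNoetherianRing R).insert _) (maximalIdeal R ^ 2)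
    (maximalIdeal R ^ 2) fun i hi hne _ => ((Set.mem_insert_iff.mp hi).resolve_left hne).1.1).mp
      hcover
  obtain rfl | hJ := Set.mem_insert_iff.mp hJ
  · refine not_maximalIdeal_le_sq (fun h0 => hht ?_) hle
    exact Ideal.height_eq_zero_iff.mpr ⟨⟨inferInstance, bot_le⟩, fun _ _ _ => h0 ▸ bot_le⟩
  · exact hht (Ideal.height_eq_zero_iff.mpr
      (le_antisymm hle (le_maximalIdeal hJ.1.1.ne_top) ▸ hJ))

theorem isDomain_of_isPrime_span_singleton [IsNoetherianRing R] {y : R}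
    (hy : y ∈ maximalIdeal R) (hprime : (Ideal.span {y}).IsPrime)
    (hmin : ∀ p ∈ minimalPrimes R, y ∉ p) : IsDomain R := by
  obtain ⟨p, hp, hpy⟩ := Ideal.exists_minimalPrimes_le (bot_le : (⊥ : Ideal R) ≤ Ideal.span {y})
  have hp_prime : p.IsPrime := hp.1.1
  -- As `p ⊆ (y)` and `y ∉ p`, we have `p = y p`, so `p = 0` by Nakayama's lemma.
  have hbot : p = ⊥ := by
    refine Submodule.eq_bot_of_le_smul_of_le_jacobson_bot (maximalIdeal R) p
      p.fg_of_isNoetherianRing (fun w hw => ?_) (maximalIdeal_le_jacobson _)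
    obtain ⟨c, rfl⟩ := Ideal.mem_span_singleton.mp (hpy hw)
    exact Submodule.smul_mem_smul hy ((hp_prime.mem_or_mem hw).resolve_left (hmin p hp))
  have : (⊥ : Ideal R).IsPrime := hbot ▸ hp_prime
  exact IsDomain.of_bot_isPrime R

theorem ringKrullDim_le_card_of_span_range [IsNoetherianRing R] {σ : Type*} [Finite σ] {x : σ → R}
    (hx : Ideal.span (Set.range x) = maximalIdeal R) : ringKrullDim R ≤ Nat.card σ := by
  refine (ringKrullDim_le_spanFinrank_maximalIdeal R).trans ?_
  rw [← hx]
  exact_mod_cast (Submodule.spanFinrank_span_le_ncard_of_finite (Set.finite_range x)).trans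
    (Finite.card_range_le x)

theorem exists_span_range_update_eq {σ : Type*} [Finite σ] [DecidableEq σ] {x : σ → R}
    (hx : Ideal.span (Set.range x) = maximalIdeal R) {y : R} (hy : y ∈ maximalIdeal R)
    (hy2 : y ∉ maximalIdeal R ^ 2) :
    ∃ j, Ideal.span (Set.range (Function.update x j y)) = maximalIdeal R := by
  cases nonempty_fintype σ
  have hxm : ∀ i, x i ∈ maximalIdeal R := fun i => hx ▸ Ideal.subset_span ⟨i, rfl⟩
  obtain ⟨a, rfl⟩ := Submodule.mem_span_range_iff_exists_fun R |>.mp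
    (hx ▸ hy : y ∈ Ideal.span (Set.range x))
  obtain ⟨j, hj⟩ : ∃ j, IsUnit (a j) := by
    by_contra! h
    refine hy2 (pow_two (maximalIdeal R) ▸ Ideal.sum_mem _ fun i _ => ?_)
    exact Ideal.mul_mem_mul ((mem_maximalIdeal _).mpr (h i)) (hxm i)
  refine ⟨j, le_antisymm (Ideal.span_le.mpr ?_) (hx ▸ Ideal.span_le.mpr ?_)⟩
  · rintro _ ⟨i, rfl⟩
    obtain rfl | hij := eq_or_ne i j
    · rwa [Function.update_self]
    · rw [Function.update_of_ne hij]
      exact hxm i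
  · set J := Ideal.span (Set.range (Function.update x j (∑ i, a i • x i)))
    have hmem : ∀ i, Function.update x j (∑ i, a i • x i) i ∈ J := fun i =>
      Ideal.subset_span ⟨i, rfl⟩
    have hne : ∀ i ≠ j, x i ∈ J := fun i hij => by
      simpa only [Function.update_of_ne hij] using hmem i
    rintro _ ⟨i, rfl⟩
    obtain rfl | hij := eq_or_ne i j
    · have hsum := hmem i
      rw [Function.update_self, ← Finset.add_sum_erase _ _ (Finset.mem_univ i)] at hsum
      exact (Ideal.unit_mul_mem_iff_mem J hj).mp ((J.add_mem_iff_left (J.sum_mem fun k hk =>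
        J.mul_mem_left _ (hne k (Finset.ne_of_mem_erase hk)))).mp hsum)
    · exact hne i hij

end LocalRing

/-- A regular system of parameters of a local ring: a family generating the maximal ideal with as
many members as the dimension of the ring. -/
structure IsRegularSystemOfParameters {R σ : Type*} [CommRing R] [IsLocalRing R] [Finite σ]
    (x : σ → R) : Prop where
  span_range : Ideal.span (Set.range x) = maximalIdeal R
  ringKrullDim_eq : ringKrullDim R = Nat.card σ

namespace IsRegularSystemOfParameters

variable {R σ : Type*} [CommRing R] [IsLocalRing R] [Finite σ] {x : σ → R}

theorem mem_maximalIdeal (hx : IsRegularSystemOfParameters x) (i : σ) : x i ∈ maximalIdeal R :=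
  hx.span_range ▸ Ideal.subset_span ⟨i, rfl⟩

theorem span_image_le (hx : IsRegularSystemOfParameters x) (s : Set σ) :
    Ideal.span (x '' s) ≤ maximalIdeal R :=
  Ideal.span_le.mpr (Set.image_subset_iff.mpr fun i _ => hx.mem_maximalIdeal i)

theorem comp_equiv (hx : IsRegularSystemOfParameters x) {τ : Type*} [Finite τ] (e : τ ≃ σ) :
    IsRegularSystemOfParameters (x ∘ e) :=
  ⟨by rw [e.surjective.range_comp, hx.span_range], by rw [hx.ringKrullDim_eq, Nat.card_congr e]⟩

open scoped Classical in
theorem exists_eq (hx : IsRegularSystemOfParameters x) {y : R} (hy : y ∈ maximalIdeal R)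
    (hy2 : y ∉ maximalIdeal R ^ 2) :
    ∃ (z : σ → R) (j : σ), IsRegularSystemOfParameters z ∧ z j = y :=
  have ⟨j, hj⟩ := exists_span_range_update_eq hx.span_range hy hy2
  ⟨_, j, ⟨hj, hx.ringKrullDim_eq⟩, Function.update_self ..⟩

variable [IsNoetherianRing R]

theorem ne_zero (hx : IsRegularSystemOfParameters x) (i : σ) : x i ≠ 0 := by
  intro h0
  have hspan : Ideal.span (Set.range fun j : ({i}ᶜ : Set σ) => x j) = maximalIdeal R := by
    refine le_antisymm (Ideal.span_le.mpr ?_) (hx.span_range ▸ Ideal.span_le.mpr ?_)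
    · rintro _ ⟨j, rfl⟩
      exact hx.mem_maximalIdeal j
    · rintro _ ⟨j, rfl⟩
      obtain rfl | hj := eq_or_ne j i
      · exact h0 ▸ zero_mem _
      · exact Ideal.subset_span ⟨⟨j, hj⟩, rfl⟩
  have hle := ringKrullDim_le_card_of_span_range hspan
  rw [hx.ringKrullDim_eq, Nat.cast_le, Nat.card_coe_set_eq, ← Set.ncard_univ] at hle
  exact absurd hle (not_le.mpr (Set.ncard_lt_ncard (Set.ssubset_univ_iff.mpr (by simp))))

theorem quotient (hx : IsRegularSystemOfParameters x) (s : Set σ)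
    [IsLocalRing (R ⧸ Ideal.span (x '' s))] :
    IsRegularSystemOfParameters fun i : ↥sᶜ => Ideal.Quotient.mk (Ideal.span (x '' s)) (x i) := by
  have hspan : Ideal.span (Set.range fun i : ↥sᶜ => Ideal.Quotient.mk (Ideal.span (x '' s)) (x i)) =
      maximalIdeal (R ⧸ Ideal.span (x '' s)) := by
    rw [← map_maximalIdeal_of_surjective _ Ideal.Quotient.mk_surjective, ← hx.span_range,
      Ideal.map_span, ← Set.range_comp]
    refine le_antisymm (Ideal.span_mono ?_) (Ideal.span_le.mpr ?_)
    · rintro _ ⟨i, rfl⟩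
      exact ⟨i, rfl⟩
    · rintro _ ⟨i, rfl⟩
      by_cases hi : i ∈ s
      · rw [Function.comp_apply, Ideal.Quotient.eq_zero_iff_mem.mpr
          (Ideal.subset_span (Set.mem_image_of_mem x hi))]
        exact zero_mem _
      · exact Ideal.subset_span ⟨⟨i, hi⟩, rfl⟩
  refine ⟨hspan, (ringKrullDim_le_card_of_span_range hspan).antisymm ?_⟩
  have hdim := ringKrullDim_le_ringKrullDim_quotient_add_encard (x '' s) (by
    rw [ringJacobson_eq_maximalIdeal]
    exact Ideal.span_le.mp (hx.span_image_le s))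
  have hencard : (x '' s).encard ≤ (s.ncard : ℕ∞) :=
    (Set.encard_image_le x s).trans_eq (Set.toFinite s).cast_ncard_eq.symm
  rw [hx.ringKrullDim_eq, ← Set.ncard_add_ncard_compl s, add_comm,
    Nat.cast_add] at hdim
  rw [Nat.card_coe_set_eq]
  refine ENat.WithBot.add_le_add_natCast_right_iff.mp (hdim.trans ?_)
  gcongr
  exact_mod_cast hencard

protected theorem isDomain (hx : IsRegularSystemOfParameters x) : IsDomain R := by
  induction hd : Nat.card σ generalizing R σ with
  | zero =>
    have : IsEmpty σ := Finite.card_eq_zero_iff.mp hd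
    exact (isField_iff_maximalIdeal_eq.mpr (by simp [← hx.span_range])).isDomain
  | succ d ih =>
    obtain ⟨y, hy, hy2, hmin⟩ := exists_mem_maximalIdeal_notMem_sq_notMem_minimalPrimes (R := R)
      (by rw [hx.ringKrullDim_eq, hd]; exact_mod_cast d.succ_ne_zero)
    obtain ⟨z, j, hz, rfl⟩ := hx.exists_eq hy hy2
    have hlocal := isLocalRing_quotient (hz.span_image_le {j})
    have hdomain := ih (hz.quotient {j}) (by
      rw [Nat.card_coe_set_eq, Set.ncard_compl, Set.ncard_singleton, hd, Nat.add_sub_cancel])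
    refine isDomain_of_isPrime_span_singleton hy ?_ hmin
    rwa [Set.image_singleton, Ideal.Quotient.isDomain_iff_prime] at hdomain

theorem isPrime_span_image (hx : IsRegularSystemOfParameters x) (s : Set σ) :
    (Ideal.span (x '' s)).IsPrime :=
  have := isLocalRing_quotient (hx.span_image_le s)
  (Ideal.Quotient.isDomain_iff_prime _).mp (hx.quotient s).isDomain

theorem notMem_span_image (hx : IsRegularSystemOfParameters x) {s : Set σ} {i : σ} (hi : i ∉ s) :
    x i ∉ Ideal.span (x '' s) :=
  have := isLocalRing_quotient (hx.span_image_le s)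
  fun h => (hx.quotient s).ne_zero ⟨i, hi⟩ (Ideal.Quotient.eq_zero_iff_mem.mpr h)

end IsRegularSystemOfParameters

theorem exists_isRegularSystemOfParameters (R : Type*) [CommRing R] [IsRegularLocalRing R] :
    ∃ (d : ℕ) (x : Fin d → R), IsRegularSystemOfParameters x := by
  obtain ⟨s, hcard, hspan⟩ := Submodule.FG.exists_span_finset_card_eq_spanFinrank
    (maximalIdeal R).fg_of_isNoetherianRing
  refine ⟨s.card, fun i => s.equivFin.symm i, ?_, ?_⟩
  · rw [← hspan, Ideal.submodule_span_eq, ← Function.comp_def Subtype.val,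
      s.equivFin.symm.surjective.range_comp, Subtype.range_coe]
  · rw [Nat.card_fin, hcard, IsRegularLocalRing.spanFinrank_maximalIdeal]

theorem exists_isRegularSystemOfParameters_zero_eq {R : Type*} [CommRing R] [IsRegularLocalRing R]
    {y : R} (hy : y ∈ maximalIdeal R) (hy2 : y ∉ maximalIdeal R ^ 2) :
    ∃ (d : ℕ) (x : Fin (d + 1) → R), IsRegularSystemOfParameters x ∧ x 0 = y := by
  obtain ⟨d, x, hx⟩ := exists_isRegularSystemOfParameters R
  obtain ⟨z, j, hz, rfl⟩ := hx.exists_eq hy hy2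
  cases d with
  | zero => exact j.elim0
  | succ d => exact ⟨d, _, hz.comp_equiv (Equiv.swap 0 j), by simp⟩

/-! ### Quasi-regular families -/

section QuasiRegular

open MvPolynomial

variable {R σ : Type*} [CommRing R]

theorem eval_mem_pow_of_isHomogeneous {F : MvPolynomial σ R} {n : ℕ} (hF : F.IsHomogeneous n)
    (x : σ → R) : eval x F ∈ Ideal.span (Set.range x) ^ n :=
  (Ideal.mem_span_pow_iff_exists_isHomogeneous x _).mpr ⟨F, hF, rfl⟩

theorem eval_mem_pow_succ_of_mem_map_C {F : MvPolynomial σ R} {n : ℕ} (hF : F.IsHomogeneous n)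
    {x : σ → R} (hFx : F ∈ (Ideal.span (Set.range x)).map C) :
    eval x F ∈ Ideal.span (Set.range x) ^ (n + 1) := by
  rw [eval_eq, pow_succ']
  refine Ideal.sum_mem _ fun α hα => Ideal.mul_mem_mul (mem_map_C_iff.mp hFx α) ?_
  have hα_deg : α.degree = n := not_not.mp fun hne =>
    mem_support_iff.mp hα (hF.coeff_eq_zero hne)
  simpa only [eval_monomial, one_mul, Finsupp.prod] using
    eval_mem_pow_of_isHomogeneous (isHomogeneous_monomial (1 : R) hα_deg) x

theorem exists_eq_rename_succ_add_X_zero_mul {d n : ℕ} {F : MvPolynomial (Fin (d + 1)) R}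
    (hF : F.IsHomogeneous (n + 1)) :
    ∃ (F₀ : MvPolynomial (Fin d) R) (G : MvPolynomial (Fin (d + 1)) R),
      F₀.IsHomogeneous (n + 1) ∧ G.IsHomogeneous n ∧ F = rename Fin.succ F₀ + X 0 * G := by
  have hC : ∀ p : MvPolynomial (Fin d) R,
      finSuccEquiv R d (rename Fin.succ p) = Polynomial.C p := fun p => by
    induction p using MvPolynomial.induction_on with
    | C a => simp [finSuccEquiv_apply]
    | add p q hp hq => simp only [map_add, hp, hq]
    | mul_X p i hp => simp only [map_mul, hp, rename_X, finSuccEquiv_X_succ]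
  set F₀ := (finSuccEquiv R d F).coeff 0
  set G := (finSuccEquiv R d).symm (finSuccEquiv R d F).divX
  have hF₀ : F₀.IsHomogeneous (n + 1) :=
    hF.finSuccEquiv_coeff_isHomogeneous 0 (n + 1) (zero_add _)
  have hFG : F = rename Fin.succ F₀ + X 0 * G := by
    apply (finSuccEquiv R d).injective
    rw [map_add, map_mul, hC, finSuccEquiv_X_zero, AlgEquiv.apply_symm_apply]
    exact ((add_comm _ _).trans (Polynomial.X_mul_divX_add _)).symm
  have hXG : (X 0 * G).IsHomogeneous (n + 1) := by
    rw [← sub_eq_iff_eq_add'.mpr hFG]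
    exact hF.sub hF₀.rename_isHomogeneous
  refine ⟨F₀, G, hF₀, fun α hα => ?_, hFG⟩
  have hdeg := @hXG (Finsupp.single 0 1 + α) (by rwa [coeff_X_mul])
  simp only [map_add, Finsupp.weight_single, Pi.one_apply, smul_eq_mul, mul_one] at hdeg
  omega

/-- A family `x` generating an ideal `J` is quasi-regular if a form whose value at `x` lies in a
power of `J` of exponent greater than its degree has all its coefficients in `J`; in other words, if
the associated graded ring of `J` is a polynomial ring over `R ⧸ J` in the classes of the members
of `x`. -/
def IsQuasiRegular (x : σ → R) : Prop :=
  ∀ ⦃n : ℕ⦄ ⦃F : MvPolynomial σ R⦄, F.IsHomogeneous n →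
    eval x F ∈ Ideal.span (Set.range x) ^ (n + 1) → F ∈ (Ideal.span (Set.range x)).map C

theorem exists_isHomogeneous_mem_map_C_eval_eq {x : σ → R} {n : ℕ} {z : R}
    (hz : z ∈ Ideal.span (Set.range x) ^ (n + 1)) :
    ∃ G : MvPolynomial σ R, G.IsHomogeneous n ∧ G ∈ (Ideal.span (Set.range x)).map C ∧
      eval x G = z := by
  rw [pow_succ'] at hz
  induction hz using Submodule.mul_induction_on' with
  | mem_mul_mem a ha b hb =>
    obtain ⟨G, hG, rfl⟩ := (Ideal.mem_span_pow_iff_exists_isHomogeneous x _).mp hb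
    refine ⟨C a * G, ?_, Ideal.mul_mem_right _ _ (Ideal.mem_map_of_mem _ ha), by simp⟩
    simpa only [zero_add] using (isHomogeneous_C σ a).mul hG
  | add y _ z _ hy hz =>
    obtain ⟨G, hG, hGx, rfl⟩ := hy
    obtain ⟨H, hH, hHx, rfl⟩ := hz
    exact ⟨G + H, hG.add hH, add_mem hGx hHx, map_add _ _ _⟩

theorem mem_map_C_of_eval_mem_pow_succ {x : σ → R} {n : ℕ}
    (h : ∀ F : MvPolynomial σ R, F.IsHomogeneous n → eval x F = 0 →
      F ∈ (Ideal.span (Set.range x)).map C) {F : MvPolynomial σ R} (hF : F.IsHomogeneous n)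
    (hFx : eval x F ∈ Ideal.span (Set.range x) ^ (n + 1)) :
    F ∈ (Ideal.span (Set.range x)).map C := by
  obtain ⟨G, hG, hGx, heval⟩ := exists_isHomogeneous_mem_map_C_eval_eq hFx
  rw [← sub_add_cancel F G]
  exact add_mem (h _ (hF.sub hG) (by rw [map_sub, heval, sub_self])) hGx

namespace IsQuasiRegular

theorem mem_pow_of_mul_mem_pow {x : σ → R} (hx : IsQuasiRegular x) {a : R}
    (ha : ∀ b, a * b ∈ Ideal.span (Set.range x) → b ∈ Ideal.span (Set.range x)) {n : ℕ} {b : R}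
    (hab : a * b ∈ Ideal.span (Set.range x) ^ n) : b ∈ Ideal.span (Set.range x) ^ n := by
  induction n with
  | zero => simp
  | succ n ih =>
    obtain ⟨G, hG, rfl⟩ := (Ideal.mem_span_pow_iff_exists_isHomogeneous x _).mp
      (ih (Ideal.pow_le_pow_right n.le_succ hab))
    refine eval_mem_pow_succ_of_mem_map_C hG (mem_map_C_iff.mpr fun α => ha _ ?_)
    have haG := hx (F := C a * G) (by simpa only [zero_add] using (isHomogeneous_C σ a).mul hG)
      (by rwa [map_mul, eval_C])
    simpa only [coeff_C_mul] using mem_map_C_iff.mp haG α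

theorem mem_pow_of_mul_mem_pow_succ {x : σ → R} (hx : IsQuasiRegular x) (i : σ) {n : ℕ} {b : R}
    (hb : x i * b ∈ Ideal.span (Set.range x) ^ (n + 1)) : b ∈ Ideal.span (Set.range x) ^ n := by
  induction n with
  | zero => simp
  | succ n ih =>
    obtain ⟨G, hG, rfl⟩ := (Ideal.mem_span_pow_iff_exists_isHomogeneous x _).mp
      (ih (Ideal.pow_le_pow_right (n + 1).le_succ hb))
    refine eval_mem_pow_succ_of_mem_map_C hG (mem_map_C_iff.mpr fun α => ?_)
    have hXG := hx (F := X i * G) ((isHomogeneous_X R i).mul hG)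
      (by rwa [map_mul, eval_X, add_comm 1 n])
    have hcoeff := mem_map_C_iff.mp hXG (Finsupp.single i 1 + α)
    rwa [coeff_X_mul] at hcoeff

theorem of_tail {d : ℕ} {x : Fin (d + 1) → R} (hx : IsQuasiRegular (Fin.tail x))
    (h0 : ∀ a, x 0 * a ∈ Ideal.span (Set.range (Fin.tail x)) →
      a ∈ Ideal.span (Set.range (Fin.tail x))) : IsQuasiRegular x := by
  have htail : Ideal.span (Set.range (Fin.tail x)) ≤ Ideal.span (Set.range x) :=
    Ideal.span_mono (Set.range_comp_subset_range Fin.succ x)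
  suffices h : ∀ n (F : MvPolynomial (Fin (d + 1)) R), F.IsHomogeneous n → eval x F = 0 →
      F ∈ (Ideal.span (Set.range x)).map C from
    fun n _ hF hFx => mem_map_C_of_eval_mem_pow_succ (h n) hF hFx
  intro n
  induction n with
  | zero =>
    intro F hF hFx
    rw [totalDegree_eq_zero_iff_eq_C.mp ((totalDegree_zero_iff_isHomogeneous _).mpr hF), eval_C]
      at hFx
    rw [totalDegree_eq_zero_iff_eq_C.mp ((totalDegree_zero_iff_isHomogeneous _).mpr hF), hFx,
      map_zero]
    exact zero_mem _
  | succ n ih =>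
    intro F hF hFx
    obtain ⟨F₀, G, hF₀, hG, rfl⟩ := exists_eq_rename_succ_add_X_zero_mul hF
    rw [map_add, map_mul, eval_rename, eval_X] at hFx
    have hGx : eval x G ∈ Ideal.span (Set.range (Fin.tail x)) ^ (n + 1) := by
      refine hx.mem_pow_of_mul_mem_pow h0 ?_
      rw [← neg_eq_of_add_eq_zero_right hFx]
      exact neg_mem (eval_mem_pow_of_isHomogeneous hF₀ _)
    have hG_mem := mem_map_C_of_eval_mem_pow_succ ih hG (Ideal.pow_right_mono htail _ hGx)
    -- `G(x)` is also the value of a form `H` in the last variables, and `F₀ + x₀ H` vanishes there.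
    obtain ⟨H, hH, hHx⟩ := (Ideal.mem_span_pow_iff_exists_isHomogeneous _ _).mp hGx
    have hF₀H : F₀ + C (x 0) * H ∈ (Ideal.span (Set.range (Fin.tail x))).map C := by
      refine hx (hF₀.add (by simpa only [zero_add] using (isHomogeneous_C _ (x 0)).mul hH)) ?_
      rw [map_add, map_mul, eval_C, hHx]
      exact (congrArg (· ∈ _) hFx).mpr (zero_mem _)
    have hx0 : x 0 ∈ Ideal.span (Set.range x) := Ideal.subset_span ⟨0, rfl⟩
    have hF₀_mem : F₀ ∈ (Ideal.span (Set.range x)).map C :=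
      (Ideal.add_mem_iff_left _ (Ideal.mul_mem_right _ _ (Ideal.mem_map_of_mem _ hx0))).mp
        (Ideal.map_mono htail hF₀H)
    refine add_mem (mem_map_C_iff.mpr fun α => ?_) (Ideal.mul_mem_left _ _ hG_mem)
    by_cases hα : ∃ β, F₀.coeff β ≠ 0 ∧ β.mapDomain Fin.succ = α
    · obtain ⟨β, -, rfl⟩ := hα
      rw [coeff_rename_mapDomain _ (Fin.succ_injective d)]
      exact mem_map_C_iff.mp hF₀_mem β
    · rw [coeff_rename_eq_zero _ _ _ fun β hβ => not_not.mp fun h => hα ⟨β, h, hβ⟩]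
      exact zero_mem _

theorem of_forall_mem_span_image_Ioi {d : ℕ} {x : Fin d → R}
    (h : ∀ i a, x i * a ∈ Ideal.span (x '' Set.Ioi i) → a ∈ Ideal.span (x '' Set.Ioi i)) :
    IsQuasiRegular x := by
  induction d with
  | zero =>
    intro n F _ hFx
    rw [mem_map_C_iff]
    intro α
    rw [Subsingleton.elim α 0]
    rw [F.eq_C_of_isEmpty, eval_C] at hFx
    exact Ideal.pow_le_self n.succ_ne_zero hFx
  | succ d ih =>
    refine of_tail (ih fun i a => ?_) ?_
    · have himage : Fin.tail x '' Set.Ioi i = x '' Set.Ioi i.succ := by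
        rw [← Fin.image_succ_Ioi, Set.image_image]
        rfl
      rw [himage]
      exact h _ a
    · have hrange : Set.range (Fin.tail x) = x '' Set.Ioi 0 := by
        have hIoi : Set.range (Fin.succ (n := d)) = Set.Ioi 0 := by
          ext i
          rw [Fin.range_succ, Set.mem_compl_singleton_iff, Set.mem_Ioi, Fin.pos_iff_ne_zero]
        rw [← hIoi, ← Set.range_comp]
        rfl
      rw [hrange]
      exact h 0

end IsQuasiRegular

theorem IsRegularSystemOfParameters.isQuasiRegular [IsLocalRing R] [IsNoetherianRing R] {d : ℕ}
    {x : Fin d → R} (hx : IsRegularSystemOfParameters x) : IsQuasiRegular x :=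
  .of_forall_mem_span_image_Ioi fun _ _ h => ((hx.isPrime_span_image _).mem_or_mem h).resolve_left
    (hx.notMem_span_image Set.self_notMem_Ioi)

theorem mem_maximalIdeal_pow_of_mul_mem_pow_succ [IsRegularLocalRing R] {y : R}
    (hy : y ∈ maximalIdeal R) (hy2 : y ∉ maximalIdeal R ^ 2) {n : ℕ} {b : R}
    (hb : y * b ∈ maximalIdeal R ^ (n + 1)) : b ∈ maximalIdeal R ^ n := by
  obtain ⟨d, x, hx, rfl⟩ := exists_isRegularSystemOfParameters_zero_eq hy hy2
  rw [← hx.span_range] at hb ⊢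
  exact hx.isQuasiRegular.mem_pow_of_mul_mem_pow_succ 0 hb

end QuasiRegular

/-! ### Affine charts of blow-ups -/

section Chart

variable {A K : Type*} [CommRing A] [Field K] [Algebra A K] {J : Ideal A} {a : A}

theorem algebraMap_mem_blowupChart (r : A) : algebraMap A K r ∈ blowupChart A K J a :=
  (Algebra.adjoin A _).algebraMap_mem r

theorem div_mem_blowupChart {b : A} (hb : b ∈ J) :
    algebraMap A K b / algebraMap A K a ∈ blowupChart A K J a :=
  Algebra.subset_adjoin ⟨b, hb, rfl⟩

theorem blowupChart_le {C : Subring K} (hA : ∀ r, algebraMap A K r ∈ C)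
    (hJ : ∀ b ∈ J, algebraMap A K b / algebraMap A K a ∈ C) : blowupChart A K J a ≤ C := by
  intro z hz
  change z ∈ Algebra.adjoin A _ at hz
  induction hz using Algebra.adjoin_induction with
  | mem z hz => obtain ⟨b, hb, rfl⟩ := hz; exact hJ b hb
  | algebraMap r => exact hA r
  | add _ _ _ _ hx hy => exact C.add_mem hx hy
  | mul _ _ _ _ hx hy => exact C.mul_mem hx hy

theorem blowupChart_mul_le_iff {J₁ J₂ : Ideal A} {x : A} (hx : x ∈ J₁) (ha : a ∈ J₂)
    (hx0 : algebraMap A K x ≠ 0) (ha0 : algebraMap A K a ≠ 0) {C : Subring K} :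
    blowupChart A K (J₁ * J₂) (x * a) ≤ C ↔
      blowupChart A K J₁ x ≤ C ∧ blowupChart A K J₂ a ≤ C := by
  constructor
  · refine fun h => ⟨blowupChart_le (fun r => h (algebraMap_mem_blowupChart r)) fun b hb => ?_,
      blowupChart_le (fun r => h (algebraMap_mem_blowupChart r)) fun c hc => ?_⟩
    · have hba := h (div_mem_blowupChart (Ideal.mul_mem_mul hb ha))
      rwa [map_mul, map_mul, mul_div_mul_right _ _ ha0] at hba
    · have hxc := h (div_mem_blowupChart (Ideal.mul_mem_mul hx hc))
      rwa [map_mul, map_mul, mul_div_mul_left _ _ hx0] at hxc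
  · rintro ⟨h₁, h₂⟩
    refine blowupChart_le (fun r => h₁ (algebraMap_mem_blowupChart r)) fun d hd => ?_
    induction hd using Submodule.mul_induction_on' with
    | mem_mul_mem b hb c hc =>
      rw [map_mul, map_mul, mul_div_mul_comm]
      exact mul_mem (h₁ (div_mem_blowupChart hb)) (h₂ (div_mem_blowupChart hc))
    | add b _ c _ hb hc =>
      rw [map_add, add_div]
      exact add_mem hb hc

theorem div_pow_mem_blowupChart {n : ℕ} {b : A} (hb : b ∈ J ^ n) :
    algebraMap A K b / algebraMap A K a ^ n ∈ blowupChart A K J a := by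
  induction hb using Submodule.pow_induction_on_left' with
  | algebraMap r => simpa using algebraMap_mem_blowupChart r
  | add x y i _ _ hx hy =>
    rw [map_add, add_div]
    exact add_mem hx hy
  | mem_mul m hm i x _ hx =>
    rw [map_mul, pow_succ', mul_div_mul_comm]
    exact mul_mem (div_mem_blowupChart hm) hx

theorem exists_eq_div_pow_of_mem_blowupChart (haJ : a ∈ J) (ha : algebraMap A K a ≠ 0) {z : K}
    (hz : z ∈ blowupChart A K J a) :
    ∃ n : ℕ, ∃ b ∈ J ^ n, z = algebraMap A K b / algebraMap A K a ^ n := by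
  change z ∈ Algebra.adjoin A _ at hz
  induction hz using Algebra.adjoin_induction with
  | mem z hz => obtain ⟨b, hb, rfl⟩ := hz; exact ⟨1, b, by simpa using hb, by simp⟩
  | algebraMap r => exact ⟨0, r, by simp, by simp⟩
  | add _ _ _ _ hx hy =>
    obtain ⟨n, b, hb, rfl⟩ := hx
    obtain ⟨m, c, hc, rfl⟩ := hy
    refine ⟨n + m, b * a ^ m + a ^ n * c, pow_add J n m ▸ add_mem
      (Ideal.mul_mem_mul hb (Ideal.pow_mem_pow haJ m))
      (Ideal.mul_mem_mul (Ideal.pow_mem_pow haJ n) hc), ?_⟩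
    simp only [map_add, map_mul, map_pow]
    field_simp
    ring
  | mul _ _ _ _ hx hy =>
    obtain ⟨n, b, hb, rfl⟩ := hx
    obtain ⟨m, c, hc, rfl⟩ := hy
    refine ⟨n + m, b * c, pow_add J n m ▸ Ideal.mul_mem_mul hb hc, ?_⟩
    rw [map_mul, pow_add, mul_div_mul_comm]

variable (A K J a) in
/-- The structure map `A → A[J/a]` of an affine chart of the blow-up of `J`. -/
def chartHom : A →+* blowupChart A K J a :=
  (algebraMap A K).codRestrict _ algebraMap_mem_blowupChart

@[simp]
theorem coe_chartHom (r : A) : (chartHom A K J a r : K) = algebraMap A K r := rfl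

end Chart

section ChartPresentation

open MvPolynomial

variable {A K : Type*} [CommRing A] [Field K] [Algebra A K] {J : Ideal A} {d : ℕ}

variable (K) in
/-- The presentation `A[X₁, …, X_d] → A[J/x₀]`, `Xᵢ ↦ xᵢ/x₀`, of the chart of the blow-up of
`J = (x₀, …, x_d)` that belongs to `x₀`; the variable `Xᵢ₊₁` is indexed by `i : Fin d`. -/
noncomputable def chartPresentation (x : Fin (d + 1) → A) (hx : Ideal.span (Set.range x) = J) :
    MvPolynomial (Fin d) A →+* blowupChart A K J (x 0) :=
  eval₂Hom (chartHom A K J (x 0)) fun i =>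
    ⟨algebraMap A K (x i.succ) / algebraMap A K (x 0),
      div_mem_blowupChart (hx ▸ Ideal.subset_span ⟨i.succ, rfl⟩)⟩

theorem coe_chartPresentation (x : Fin (d + 1) → A) (hx : Ideal.span (Set.range x) = J)
    (f : MvPolynomial (Fin d) A) :
    (chartPresentation K x hx f : K) =
      eval₂ (algebraMap A K) (fun i => algebraMap A K (x i.succ) / algebraMap A K (x 0)) f :=
  eval₂_comp_left (blowupChart A K J (x 0)).subtype (chartHom A K J (x 0)) _ f

theorem chartPresentation_surjective (x : Fin (d + 1) → A) (hx : Ideal.span (Set.range x) = J)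
    (hx0 : algebraMap A K (x 0) ≠ 0) : Function.Surjective (chartPresentation K x hx) := by
  have hC : ∀ r, algebraMap A K r ∈
      ((blowupChart A K J (x 0)).subtype.comp (chartPresentation K x hx)).range := fun r =>
    ⟨C r, by simp [coe_chartPresentation]⟩
  have hle : blowupChart A K J (x 0) ≤
      ((blowupChart A K J (x 0)).subtype.comp (chartPresentation K x hx)).range := by
    refine blowupChart_le hC fun b hb => ?_
    obtain ⟨c, rfl⟩ := Submodule.mem_span_range_iff_exists_fun A |>.mp (hx ▸ hb :
      b ∈ Ideal.span (Set.range x))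
    rw [map_sum, Finset.sum_div]
    refine sum_mem fun i _ => ?_
    rw [smul_eq_mul, map_mul, mul_div_assoc]
    refine mul_mem (hC _) (Fin.cases ?_ (fun i => ?_) i)
    · rw [div_self hx0]
      exact one_mem _
    · exact ⟨X i, by simp [coe_chartPresentation]⟩
  intro z
  obtain ⟨f, hf⟩ := hle z.2
  exact ⟨f, Subtype.ext hf⟩

/-- The homogenization of degree `N` of a polynomial, of total degree at most `N`, with respect to
a new first variable. -/
noncomputable def homogenization (N : ℕ) (f : MvPolynomial (Fin d) A) :
    MvPolynomial (Fin (d + 1)) A :=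
  ∑ α ∈ f.support, monomial (Finsupp.cons (N - α.degree) α) (coeff α f)

theorem isHomogeneous_homogenization {N : ℕ} {f : MvPolynomial (Fin d) A}
    (hN : f.totalDegree ≤ N) : (homogenization N f).IsHomogeneous N := by
  refine IsHomogeneous.sum _ _ _ fun α hα => isHomogeneous_monomial _ ?_
  have hdeg := (le_totalDegree hα).trans hN
  simp only [Finsupp.degree_eq_sum, Fin.sum_univ_succ, Finsupp.cons_zero, Finsupp.cons_succ]
  rw [Finsupp.sum_fintype _ _ fun _ => rfl] at hdeg
  omega

theorem coeff_homogenization (N : ℕ) (f : MvPolynomial (Fin d) A) (α : Fin d →₀ ℕ) :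
    coeff (Finsupp.cons (N - α.degree) α) (homogenization N f) = coeff α f := by
  rw [homogenization, coeff_sum, Finset.sum_eq_single α, coeff_monomial, if_pos rfl]
  · intro β _ hβ
    rw [coeff_monomial, if_neg]
    exact fun h => hβ (by simpa using congrArg Finsupp.tail h)
  · intro hα
    rw [coeff_monomial, if_pos rfl, notMem_support_iff.mp hα]

theorem algebraMap_eval_homogenization {N : ℕ} {f : MvPolynomial (Fin d) A}
    (hN : f.totalDegree ≤ N) {x : Fin (d + 1) → A} (hx0 : algebraMap A K (x 0) ≠ 0) :
    algebraMap A K (eval x (homogenization N f)) = algebraMap A K (x 0) ^ N *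
      eval₂ (algebraMap A K) (fun i => algebraMap A K (x i.succ) / algebraMap A K (x 0)) f := by
  rw [homogenization, eval₂_eq', map_sum, map_sum, Finset.mul_sum]
  refine Finset.sum_congr rfl fun α hα => ?_
  have hdeg := (le_totalDegree hα).trans hN
  rw [Finsupp.sum_fintype _ _ fun _ => rfl] at hdeg
  rw [eval_monomial, Finsupp.prod_fintype _ _ fun _ => pow_zero _, Fin.prod_univ_succ]
  simp only [Finsupp.cons_zero, Finsupp.cons_succ, map_mul, map_pow, map_prod, div_pow,
    Finset.prod_div_distrib, Finset.prod_pow_eq_pow_sum, Finsupp.degree_eq_sum]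
  obtain ⟨k, hk⟩ := Nat.exists_eq_add_of_le hdeg
  rw [hk, Nat.add_sub_cancel_left, pow_add]
  field_simp

theorem chartPresentation_mem_span_iff [FaithfulSMul A K] {x : Fin (d + 1) → A}
    (hxreg : IsQuasiRegular x) (hx : Ideal.span (Set.range x) = J)
    (hx0 : algebraMap A K (x 0) ≠ 0) (f : MvPolynomial (Fin d) A) :
    chartPresentation K x hx f ∈ Ideal.span {chartHom A K J (x 0) (x 0)} ↔ f ∈ J.map C := by
  subst hx
  have hx0J : x 0 ∈ Ideal.span (Set.range x) := Ideal.subset_span ⟨0, rfl⟩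
  constructor
  · intro h
    obtain ⟨w, hw⟩ := Ideal.mem_span_singleton.mp h
    obtain ⟨n, b, hb, hwb⟩ := exists_eq_div_pow_of_mem_blowupChart hx0J hx0 w.2
    set N := f.totalDegree + n with hN
    have heval : eval x (homogenization N f) = x 0 ^ (f.totalDegree + 1) * b := by
      apply FaithfulSMul.algebraMap_injective A K
      rw [algebraMap_eval_homogenization (by omega) hx0, ← coe_chartPresentation x rfl, hw]
      simp only [Subring.coe_mul, coe_chartHom, hwb, map_mul, map_pow, hN]
      field_simp
      ring
    refine mem_map_C_iff.mpr fun α => coeff_homogenization N f α ▸ mem_map_C_iff.mp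
      (hxreg (isHomogeneous_homogenization (by omega)) ?_) _
    rw [heval, show N + 1 = f.totalDegree + 1 + n by omega, pow_add _ (_ + 1) n]
    exact Ideal.mul_mem_mul (Ideal.pow_mem_pow hx0J _) hb
  · intro h
    have hmap := Ideal.mem_map_of_mem (chartPresentation K x rfl) h
    rw [Ideal.map_map] at hmap
    refine (Ideal.map_le_iff_le_comap.mpr fun b hb => ?_) hmap
    rw [Ideal.mem_comap, Ideal.mem_span_singleton]
    exact ⟨⟨_, div_mem_blowupChart hb⟩, Subtype.ext (by
      simp [coe_chartPresentation, mul_div_cancel₀ _ hx0])⟩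

theorem nonempty_quotient_equiv_mvPolynomial [FaithfulSMul A K] {x : Fin (d + 1) → A}
    (hxreg : IsQuasiRegular x) (hx : Ideal.span (Set.range x) = J)
    (hx0 : algebraMap A K (x 0) ≠ 0) :
    Nonempty (blowupChart A K J (x 0) ⧸ Ideal.span {chartHom A K J (x 0) (x 0)} ≃+*
      MvPolynomial (Fin d) (A ⧸ J)) := by
  let ψ := (Ideal.Quotient.mk (Ideal.span {chartHom A K J (x 0) (x 0)})).comp
    (chartPresentation K x hx)
  have hψ : Function.Surjective ψ :=
    Ideal.Quotient.mk_surjective.comp (chartPresentation_surjective x hx hx0)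
  have hker : RingHom.ker ψ = RingHom.ker (map (σ := Fin d) (Ideal.Quotient.mk J)) := by
    ext f
    rw [ker_map, Ideal.mk_ker, ← chartPresentation_mem_span_iff (K := K) hxreg hx hx0,
      RingHom.mem_ker, RingHom.comp_apply, Ideal.Quotient.eq_zero_iff_mem]
  exact ⟨(RingHom.quotientKerEquivOfSurjective hψ).symm.trans
    ((Ideal.quotEquivOfEq hker).trans (RingHom.quotientKerEquivOfSurjective
      (map_surjective _ Ideal.Quotient.mk_surjective)))⟩

end ChartPresentation

section RegularChart

variable {R K : Type*} [CommRing R] [IsRegularLocalRing R] [Field K] [Algebra R K]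
  [FaithfulSMul R K] {y : R}

theorem algebraMap_ne_zero_of_notMem_sq (hy2 : y ∉ maximalIdeal R ^ 2) : algebraMap R K y ≠ 0 :=
  fun h => hy2 (FaithfulSMul.algebraMap_injective R K (h.trans (map_zero _).symm) ▸ zero_mem _)

theorem mem_maximalIdeal_pow_of_eq_pow_mul (hy : y ∈ maximalIdeal R)
    (hy2 : y ∉ maximalIdeal R ^ 2) {n : ℕ} {g : R} {z : K}
    (hz : z ∈ blowupChart R K (maximalIdeal R) y)
    (hgz : algebraMap R K g = algebraMap R K y ^ n * z) : g ∈ maximalIdeal R ^ n := by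
  have hy0 : algebraMap R K y ≠ 0 := algebraMap_ne_zero_of_notMem_sq hy2
  obtain ⟨j, w, hw, rfl⟩ := exists_eq_div_pow_of_mem_blowupChart hy hy0 hz
  have hgw : y ^ j * g = y ^ n * w := by
    apply FaithfulSMul.algebraMap_injective R K
    simp only [map_mul, map_pow, hgz]
    field_simp
  have hg : y ^ j * g ∈ maximalIdeal R ^ (n + j) := by
    rw [hgw, pow_add]
    exact Ideal.mul_mem_mul (Ideal.pow_mem_pow hy n) hw
  clear hgw hgz hz hw
  induction j with
  | zero => simpa using hg
  | succ j ih =>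
    refine ih (mem_maximalIdeal_pow_of_mul_mem_pow_succ hy hy2 ?_)
    rwa [← mul_assoc, ← pow_succ', add_assoc]

theorem exists_quotient_equiv_mvPolynomial (hy : y ∈ maximalIdeal R)
    (hy2 : y ∉ maximalIdeal R ^ 2) :
    ∃ d : ℕ, Nonempty (blowupChart R K (maximalIdeal R) y ⧸
      Ideal.span {chartHom R K (maximalIdeal R) y y} ≃+*
        MvPolynomial (Fin d) (ResidueField R)) := by
  obtain ⟨d, x, hx, rfl⟩ := exists_isRegularSystemOfParameters_zero_eq hy hy2
  exact ⟨d, nonempty_quotient_equiv_mvPolynomial hx.isQuasiRegular hx.span_range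
    (algebraMap_ne_zero_of_notMem_sq hy2)⟩

theorem isNoetherianRing_blowupChart (hy : y ∈ maximalIdeal R) (hy2 : y ∉ maximalIdeal R ^ 2) :
    IsNoetherianRing (blowupChart R K (maximalIdeal R) y) := by
  obtain ⟨d, x, hx, rfl⟩ := exists_isRegularSystemOfParameters_zero_eq hy hy2
  exact isNoetherianRing_of_surjective _ _ _
    (chartPresentation_surjective x hx.span_range (algebraMap_ne_zero_of_notMem_sq hy2))

end RegularChart

/-! ### Lifting normality and regularity from a hypersurface -/

section Lifting

variable {S : Type*} [CommRing S]

theorem isAlmostIntegral_div_iff [IsDomain S] {K : Type*} [Field K] [Algebra S K]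
    [FaithfulSMul S K] {y z : S} (hz : z ≠ 0) :
    IsAlmostIntegral S (algebraMap S K y / algebraMap S K z) ↔
      ∃ c ≠ 0, ∀ n, z ^ n ∣ c * y ^ n := by
  have hinj := FaithfulSMul.algebraMap_injective S K
  have hz' : algebraMap S K z ≠ 0 := (map_ne_zero_iff _ hinj).mpr hz
  refine exists_congr fun c => and_congr mem_nonZeroDivisors_iff_ne_zero
    (forall_congr' fun n => exists_congr fun w => ?_)
  rw [Algebra.smul_def, div_pow, ← mul_div_assoc, eq_div_iff (pow_ne_zero _ hz'), ← map_pow,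
    ← map_pow, ← map_mul, ← map_mul, hinj.eq_iff, eq_comm, mul_comm w]

theorem isIntegrallyClosed_iff_forall_dvd [IsDomain S] [IsNoetherianRing S] :
    IsIntegrallyClosed S ↔
      ∀ c y z : S, c ≠ 0 → z ≠ 0 → (∀ n, z ^ n ∣ c * y ^ n) → z ∣ y := by
  have hinj := FaithfulSMul.algebraMap_injective S (FractionRing S)
  rw [isIntegrallyClosed_iff (FractionRing S)]
  constructor
  · intro h c y z hc hz hdvd
    obtain ⟨w, hw⟩ := h ((isAlmostIntegral_div_iff (K := FractionRing S) hz).mpr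
      ⟨c, hc, hdvd⟩).isIntegral
    refine ⟨w, hinj ?_⟩
    rw [map_mul, hw, mul_div_cancel₀ _ ((map_ne_zero_iff _ hinj).mpr hz)]
  · intro h w hw
    obtain ⟨y, z, hz, rfl⟩ := IsFractionRing.div_surjective (A := S) w
    have hz0 := nonZeroDivisors.ne_zero hz
    obtain ⟨c, hc, hdvd⟩ := (isAlmostIntegral_div_iff hz0).mp hw.isAlmostIntegral
    obtain ⟨b, rfl⟩ := h c y z hc hz0 hdvd
    exact ⟨b, by rw [map_mul, mul_div_cancel_left₀ _ ((map_ne_zero_iff _ hinj).mpr hz0)]⟩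

variable [IsDomain S] {x : S}

theorem pow_dvd_of_pow_dvd_prime_pow_mul (hx : Prime x) {z t : S} (hxz : ¬ x ∣ z) {n k : ℕ}
    (h : z ^ n ∣ x ^ k * t) : z ^ n ∣ t := by
  obtain ⟨w, hw⟩ := h
  obtain ⟨w, rfl⟩ := hx.pow_dvd_of_dvd_mul_left k (fun h => hxz (hx.dvd_of_dvd_pow h))
    (Dvd.intro _ hw)
  exact ⟨w, mul_left_cancel₀ (pow_ne_zero k hx.ne_zero) (by rw [hw]; ring)⟩

omit [IsDomain S] in
theorem pow_dvd_mul_sub_mul_pow {c y z : S} (h : ∀ n, z ^ n ∣ c * y ^ n) (b : S) (n : ℕ) :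
    z ^ n ∣ c * (y - z * b) ^ n := by
  rw [sub_eq_add_neg, add_pow, Finset.mul_sum]
  refine Finset.dvd_sum fun i hi => ?_
  obtain ⟨j, rfl⟩ := Nat.exists_eq_add_of_le (Finset.mem_range_succ_iff.mp hi)
  have hterm : c * (y ^ i * (-(z * b)) ^ (i + j - i) * ((i + j).choose i : S)) =
      c * y ^ i * z ^ j * ((-b) ^ j * ((i + j).choose i : S)) := by
    rw [Nat.add_sub_cancel_left]
    ring
  rw [hterm, pow_add]
  exact (mul_dvd_mul_right (h i) _).mul_right _

theorem exists_eq_mul_add_prime_mul (hx : Prime x) [IsNoetherianRing S]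
    [IsDomain (S ⧸ Ideal.span {x})] [IsIntegrallyClosed (S ⧸ Ideal.span {x})] {c y z : S}
    (hc : ¬ x ∣ c) (hz : ¬ x ∣ z) (h : ∀ n, z ^ n ∣ c * y ^ n) :
    ∃ b y', y = z * b + x * y' ∧ ∀ n, z ^ n ∣ c * y' ^ n := by
  have hmk : ∀ s : S, Ideal.Quotient.mk (Ideal.span {x}) s = 0 ↔ x ∣ s := fun s =>
    Ideal.Quotient.eq_zero_iff_mem.trans Ideal.mem_span_singleton
  obtain ⟨b, hb⟩ := isIntegrallyClosed_iff_forall_dvd.mp ‹_› _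
    (Ideal.Quotient.mk (Ideal.span {x}) y) _ (mt (hmk c).mp hc) (mt (hmk z).mp hz) fun n => by
      simpa only [map_mul, map_pow] using map_dvd (Ideal.Quotient.mk (Ideal.span {x})) (h n)
  obtain ⟨b, rfl⟩ := Ideal.Quotient.mk_surjective b
  rw [← map_mul, Ideal.Quotient.eq, Ideal.mem_span_singleton] at hb
  obtain ⟨y', hy'⟩ := hb
  refine ⟨b, y', by rw [← hy']; ring, fun n =>
    pow_dvd_of_pow_dvd_prime_pow_mul hx hz (k := n) ?_⟩
  rw [show x ^ n * (c * y' ^ n) = c * (x * y') ^ n by ring, ← hy']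
  exact pow_dvd_mul_sub_mul_pow h b n

theorem dvd_of_forall_pow_dvd_mul_pow [IsLocalRing S] [IsNoetherianRing S] (hx : Prime x)
    [IsDomain (S ⧸ Ideal.span {x})] [IsIntegrallyClosed (S ⧸ Ideal.span {x})] {c y z : S}
    (hc : ¬ x ∣ c) (hz : ¬ x ∣ z) (h : ∀ n, z ^ n ∣ c * y ^ n) : z ∣ y := by
  have hiter : ∀ k : ℕ, ∃ b y', y = z * b + x ^ k * y' ∧ ∀ n, z ^ n ∣ c * y' ^ n := by
    intro k
    induction k with
    | zero => exact ⟨0, y, by simp, h⟩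
    | succ k ih =>
      obtain ⟨b, y', rfl, hy'⟩ := ih
      obtain ⟨b', y'', rfl, hy''⟩ := exists_eq_mul_add_prime_mul hx hc hz hy'
      exact ⟨b + x ^ k * b', y'', by ring, hy''⟩
  have hxm : x ∈ maximalIdeal S := (mem_maximalIdeal x).mpr hx.not_isUnit
  have hhausdorff : IsHausdorff (maximalIdeal S) (S ⧸ Ideal.span {z}) := by
    infer_instance
  rw [← Ideal.mem_span_singleton, ← Ideal.Quotient.eq_zero_iff_mem]
  refine hhausdorff.haus _ fun k => SModEq.zero.mpr ?_
  obtain ⟨b, y', hy, -⟩ := hiter k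
  rw [hy, map_add, Ideal.Quotient.eq_zero_iff_mem.mpr
    (Ideal.mul_mem_right _ _ (Ideal.mem_span_singleton_self z)), zero_add]
  exact Submodule.smul_mem_smul (Ideal.pow_mem_pow hxm k)
    (Submodule.mem_top (x := Ideal.Quotient.mk (Ideal.span {z}) y'))

theorem prime_pow_dvd_of_forall_pow_dvd (hx : Prime x) {c y z : S} (hc : ¬ x ∣ c) {k m : ℕ}
    (h : ∀ n, (x ^ m * z) ^ n ∣ x ^ k * c * y ^ n) : x ^ m ∣ y := by
  induction m generalizing y with
  | zero => simp
  | succ m ih =>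
    have hxy : x ∣ y := by
      have hdvd : x ^ k * x ∣ x ^ k * (c * y ^ (k + 1)) := by
        rw [← pow_succ, ← mul_assoc]
        refine dvd_trans ?_ (h (k + 1))
        rw [mul_pow, ← pow_mul]
        exact (pow_dvd_pow _ (Nat.le_mul_of_pos_left _ m.succ_pos)).mul_right _
      exact hx.dvd_of_dvd_pow ((hx.dvd_or_dvd ((mul_dvd_mul_iff_left
        (pow_ne_zero k hx.ne_zero)).mp hdvd)).resolve_left hc)
    obtain ⟨y, rfl⟩ := hxy
    rw [pow_succ']
    refine mul_dvd_mul_left x (ih fun n => (mul_dvd_mul_iff_left (pow_ne_zero n hx.ne_zero)).mp ?_)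
    convert h n using 1 <;> ring

theorem isIntegrallyClosed_of_quotient_prime [IsLocalRing S] [IsNoetherianRing S] (hx : Prime x)
    [IsDomain (S ⧸ Ideal.span {x})] [IsIntegrallyClosed (S ⧸ Ideal.span {x})] :
    IsIntegrallyClosed S := by
  refine isIntegrallyClosed_iff_forall_dvd.mpr fun c y z hc hz h => ?_
  obtain ⟨c, hxc, hc_eq⟩ :=
    (FiniteMultiplicity.of_not_isUnit hx.not_isUnit hc).exists_eq_pow_mul_and_not_dvd
  obtain ⟨z, hxz, hz_eq⟩ :=
    (FiniteMultiplicity.of_not_isUnit hx.not_isUnit hz).exists_eq_pow_mul_and_not_dvd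
  generalize multiplicity x _ = k at hxc
  generalize multiplicity x _ = m at hxz
  subst hxc hxz
  obtain ⟨y, rfl⟩ := prime_pow_dvd_of_forall_pow_dvd hx hc_eq h
  refine mul_dvd_mul_left _ (dvd_of_forall_pow_dvd_mul_pow hx hc_eq hz_eq fun n =>
    pow_dvd_of_pow_dvd_prime_pow_mul hx hz_eq (k := k)
      ((mul_dvd_mul_iff_left (pow_ne_zero (m * n) hx.ne_zero)).mp ?_))
  convert h n using 1 <;> ring

omit [IsDomain S] in
theorem isRegularLocalRing_of_quotient [IsLocalRing S] [IsNoetherianRing S]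
    (hx : x ∈ nonZeroDivisors S) (hxm : x ∈ maximalIdeal S)
    [IsRegularLocalRing (S ⧸ Ideal.span {x})] : IsRegularLocalRing S := by
  obtain ⟨d, u, hu⟩ := exists_isRegularSystemOfParameters (S ⧸ Ideal.span {x})
  obtain ⟨v, rfl⟩ : ∃ v : Fin d → S, Ideal.Quotient.mk (Ideal.span {x}) ∘ v = u :=
    Ideal.Quotient.mk_surjective.comp_left u
  have hspan : Ideal.span (Set.range (Fin.cons x v : Fin (d + 1) → S)) = maximalIdeal S := by
    have hcomap : (maximalIdeal (S ⧸ Ideal.span {x})).comap (Ideal.Quotient.mk (Ideal.span {x})) =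
        maximalIdeal S :=
      eq_maximalIdeal (Ideal.comap_isMaximal_of_surjective _ Ideal.Quotient.mk_surjective)
    rw [Fin.range_cons, Set.insert_eq, Ideal.span_union, sup_comm, ← hcomap, ← hu.span_range,
      Set.range_comp, ← Ideal.map_span, Ideal.comap_map_of_surjective _
      Ideal.Quotient.mk_surjective, ← RingHom.ker_eq_comap_bot, Ideal.mk_ker]
  refine IsRegularLocalRing.of_spanFinrank_maximalIdeal_le _ ?_
  rw [← ringKrullDim_quotient_span_singleton_succ_eq_ringKrullDim_of_mem_nonZeroDivisors hx hxm,
    hu.ringKrullDim_eq, Nat.card_fin, ← hspan]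
  exact_mod_cast (Submodule.spanFinrank_span_le_ncard_of_finite (Set.finite_range _)).trans
    ((Finite.card_range_le _).trans_eq (Nat.card_fin _))

end Lifting

section OfPrime

variable {K : Type*} [Field K] {A : Subring K} {P : Ideal A}

theorem coe_ne_zero_of_notMem {t : A} (ht : t ∉ P) : (t : K) ≠ 0 :=
  fun h0 => ht ((Subtype.ext h0 : t = 0) ▸ zero_mem _)

theorem mem_ofPrime_iff [P.IsPrime] {z : K} :
    z ∈ (LocalSubring.ofPrime A P).toSubring ↔ ∃ s t : A, t ∉ P ∧ z = s / t := by
  constructor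
  · intro hz
    obtain ⟨s, t, h⟩ := IsLocalization.exists_mk'_eq P.primeCompl
      (⟨z, hz⟩ : (LocalSubring.ofPrime A P).toSubring)
    rw [IsLocalization.mk'_eq_iff_eq_mul] at h
    exact ⟨s, t, t.2, (eq_div_iff (coe_ne_zero_of_notMem t.2)).mpr (congrArg Subtype.val h).symm⟩
  · rintro ⟨s, t, ht, rfl⟩
    obtain ⟨u, hu⟩ := (IsLocalization.map_units (LocalSubring.ofPrime A P).toSubring
      (⟨t, ht⟩ : P.primeCompl)).exists_left_inv
    have hu_eq : (u : K) = (t : K)⁻¹ := eq_inv_of_mul_eq_one_left (congrArg Subtype.val hu)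
    rw [div_eq_mul_inv, ← hu_eq]
    exact mul_mem (LocalSubring.le_ofPrime A P s.2) u.2

end OfPrime

theorem exists_quotient_map_equiv_localization {D S T : Type*} [CommRing D] [CommRing S]
    [CommRing T] [Algebra D S] (Q : Ideal D) [Q.IsPrime] [IsLocalization.AtPrime S Q] {L : Ideal D}
    (hL : L ≤ Q) (e : D ⧸ L ≃+* T) :
    ∃ (Q' : Ideal T) (_ : Q'.IsPrime),
      Nonempty (S ⧸ L.map (algebraMap D S) ≃+* Localization.AtPrime Q') := by
  set q := Q.map (Ideal.Quotient.mk L)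
  have hq : q.IsPrime := Ideal.isPrime_map_quotientMk_of_isPrime hL
  have hcomap : q.comap (Ideal.Quotient.mk L) = Q := by
    rw [Ideal.comap_map_of_surjective _ Ideal.Quotient.mk_surjective, ← RingHom.ker_eq_comap_bot,
      Ideal.mk_ker, sup_eq_left.mpr hL]
  have hM : Algebra.algebraMapSubmonoid (D ⧸ L) Q.primeCompl = q.primeCompl := by
    ext z
    obtain ⟨z, rfl⟩ := Ideal.Quotient.mk_surjective z
    constructor
    · rintro ⟨w, hw, hwz⟩
      exact hwz ▸ fun h => hw (hcomap ▸ h)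
    · exact fun h => ⟨z, fun hz => h (Ideal.mem_map_of_mem _ hz), rfl⟩
  have hloc : IsLocalization (Algebra.algebraMapSubmonoid (D ⧸ L) Q.primeCompl)
    (S ⧸ L.map (algebraMap D S)) := inferInstance
  rw [hM] at hloc
  refine ⟨q.comap (e.symm : T →+* D ⧸ L), inferInstance, ⟨IsLocalization.ringEquivOfRingEquiv
    (M := q.primeCompl) (T := (q.comap (e.symm : T →+* D ⧸ L)).primeCompl) _ _ e ?_⟩⟩
  ext z
  constructor
  · rintro ⟨w, hw, rfl⟩ h
    exact hw (by simpa using h)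
  · exact fun h => ⟨e.symm z, h, by simp⟩

/-! ### Regularity of the blow-up along the exceptional fibre -/

section LocalChart

variable {R K : Type*} [CommRing R] [IsRegularLocalRing R] [Field K] [Algebra R K]
  [FaithfulSMul R K] {y : R}

theorem exists_quotient_ofPrime_chart_equiv (hy : y ∈ maximalIdeal R)
    (hy2 : y ∉ maximalIdeal R ^ 2) (Q : Ideal (blowupChart R K (maximalIdeal R) y)) [Q.IsPrime]
    (hQ : chartHom R K (maximalIdeal R) y y ∈ Q) {w : (LocalSubring.ofPrime _ Q).toSubring}
    (hw : (w : K) = algebraMap R K y) :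
    ∃ (d : ℕ) (Q' : Ideal (MvPolynomial (Fin d) (ResidueField R))) (_ : Q'.IsPrime),
      Nonempty ((LocalSubring.ofPrime _ Q).toSubring ⧸ Ideal.span {w} ≃+*
        Localization.AtPrime Q') := by
  obtain ⟨d, ⟨e⟩⟩ := exists_quotient_equiv_mvPolynomial (K := K) hy hy2
  have hmap : (Ideal.span {chartHom R K (maximalIdeal R) y y}).map
      (algebraMap _ (LocalSubring.ofPrime _ Q).toSubring) = Ideal.span {w} := by
    rw [Ideal.map_span, Set.image_singleton]
    congr 2
    exact Subtype.ext hw.symm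
  exact ⟨d, hmap ▸ exists_quotient_map_equiv_localization
    (S := (LocalSubring.ofPrime _ Q).toSubring) Q ((Ideal.span_singleton_le_iff_mem _).mpr hQ) e⟩

theorem isNoetherianRing_ofPrime_chart (hy : y ∈ maximalIdeal R)
    (hy2 : y ∉ maximalIdeal R ^ 2) (Q : Ideal (blowupChart R K (maximalIdeal R) y)) [Q.IsPrime] :
    IsNoetherianRing (LocalSubring.ofPrime _ Q).toSubring :=
  IsLocalization.isNoetherianRing Q.primeCompl _ (isNoetherianRing_blowupChart hy hy2)

theorem prime_ofPrime_chart (hy : y ∈ maximalIdeal R)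
    (hy2 : y ∉ maximalIdeal R ^ 2) (Q : Ideal (blowupChart R K (maximalIdeal R) y)) [Q.IsPrime]
    (hQ : chartHom R K (maximalIdeal R) y y ∈ Q) {w : (LocalSubring.ofPrime _ Q).toSubring}
    (hw : (w : K) = algebraMap R K y) : Prime w := by
  obtain ⟨d, Q', hQ', ⟨e⟩⟩ := exists_quotient_ofPrime_chart_equiv hy hy2 Q hQ hw
  refine (Ideal.span_singleton_prime ?_).mp
    ((Ideal.Quotient.isDomain_iff_prime _).mp (e.toMulEquiv.isDomain _))
  rintro rfl
  exact algebraMap_ne_zero_of_notMem_sq hy2 hw.symm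

theorem isIntegrallyClosed_ofPrime_chart (hy : y ∈ maximalIdeal R)
    (hy2 : y ∉ maximalIdeal R ^ 2) (Q : Ideal (blowupChart R K (maximalIdeal R) y)) [Q.IsPrime]
    (hQ : chartHom R K (maximalIdeal R) y y ∈ Q) :
    IsIntegrallyClosed (LocalSubring.ofPrime _ Q).toSubring := by
  let w : (LocalSubring.ofPrime _ Q).toSubring :=
    ⟨algebraMap R K y, LocalSubring.le_ofPrime _ Q (algebraMap_mem_blowupChart y)⟩
  obtain ⟨d, Q', hQ', ⟨e⟩⟩ := exists_quotient_ofPrime_chart_equiv hy hy2 Q hQ (w := w) rfl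
  have := isNoetherianRing_ofPrime_chart hy hy2 Q
  have := e.toMulEquiv.isDomain
  have hnormal : IsIntegrallyClosed (Localization.AtPrime Q') :=
    isIntegrallyClosed_of_isLocalization _ Q'.primeCompl Q'.primeCompl_le_nonZeroDivisors
  have := hnormal.of_equiv e.symm
  exact isIntegrallyClosed_of_quotient_prime (prime_ofPrime_chart hy hy2 Q hQ (w := w) rfl)

theorem isRegularLocalRing_ofPrime_chart (hy : y ∈ maximalIdeal R)
    (hy2 : y ∉ maximalIdeal R ^ 2) (Q : Ideal (blowupChart R K (maximalIdeal R) y)) [Q.IsPrime]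
    (hQ : chartHom R K (maximalIdeal R) y y ∈ Q) :
    IsRegularLocalRing (LocalSubring.ofPrime _ Q).toSubring := by
  let w : (LocalSubring.ofPrime _ Q).toSubring :=
    ⟨algebraMap R K y, LocalSubring.le_ofPrime _ Q (algebraMap_mem_blowupChart y)⟩
  obtain ⟨d, Q', hQ', ⟨e⟩⟩ := exists_quotient_ofPrime_chart_equiv hy hy2 Q hQ (w := w) rfl
  have := isNoetherianRing_ofPrime_chart hy hy2 Q
  have hprime : Prime w := prime_ofPrime_chart hy hy2 Q hQ rfl
  have : IsRegularLocalRing ((LocalSubring.ofPrime _ Q).toSubring ⧸ Ideal.span {w}) :=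
    .of_ringEquiv e.symm
  exact isRegularLocalRing_of_quotient (mem_nonZeroDivisors_of_ne_zero hprime.ne_zero)
    ((mem_maximalIdeal w).mpr hprime.not_isUnit)

end LocalChart

/-! ### Saturated subrings of a valuation ring -/

section Saturated

variable {K : Type*} [Field K]

/-- A subring `C` of a valuation ring `V` of `K` is saturated if it is integrally closed in `K` and
contains the inverses of those of its elements that are units of `V`. Saturated subrings replace
the local rings of the normalized blow-up at the center of `V`. -/
structure IsSaturatedIn (V : ValuationSubring K) (C : Subring K) : Prop where
  le : C ≤ V.toSubring
  inv_mem : ∀ t ∈ C, t⁻¹ ∈ V → t⁻¹ ∈ C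
  integral_mem : ∀ z : K, IsIntegral C z → z ∈ C

theorem isIntegral_mono {B C : Subring K} (h : B ≤ C) {z : K} (hz : IsIntegral B z) :
    IsIntegral C z := by
  obtain ⟨p, hp, hpz⟩ := hz
  refine ⟨p.map (Subring.inclusion h), hp.map _, ?_⟩
  rw [Polynomial.eval₂_map]
  exact hpz

theorem mem_valuationSubring_of_isIntegral (V : ValuationSubring K) {z : K}
    (hz : IsIntegral V.toSubring z) : z ∈ V := by
  obtain ⟨w, rfl⟩ := IsIntegrallyClosed.isIntegral_iff.mp (show IsIntegral V z from hz)
  exact w.2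

/-- The center of a valuation ring on a subring. -/
def center (V : ValuationSubring K) (B : Subring K) (h : B ≤ V.toSubring) : Ideal B :=
  (maximalIdeal V).comap (Subring.inclusion h : B →+* V)

instance (V : ValuationSubring K) (B : Subring K) (h : B ≤ V.toSubring) :
    (center V B h).IsPrime :=
  inferInstanceAs ((maximalIdeal V).comap (Subring.inclusion h : B →+* V)).IsPrime

theorem mem_center_iff {V : ValuationSubring K} {B : Subring K} {h : B ≤ V.toSubring} {b : B} :
    b ∈ center V B h ↔ V.valuation (b : K) < 1 :=
  V.valuation_lt_one_iff (Subring.inclusion h b)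

theorem notMem_center_iff {V : ValuationSubring K} {B : Subring K} {h : B ≤ V.toSubring} {b : B} :
    b ∉ center V B h ↔ V.valuation (b : K) = 1 := by
  rw [mem_center_iff, not_lt]
  exact ⟨fun h1 => le_antisymm ((V.valuation_le_one_iff _).mpr (h b.2)) h1, fun h1 => h1.ge⟩

theorem isSaturatedIn_ofPrime_center_of_isIntegral {V : ValuationSubring K} {B : Subring K}
    (h : B ≤ V.toSubring) (hB : ∀ z : K,
      IsIntegral (LocalSubring.ofPrime B (center V B h)).toSubring z →
        z ∈ (LocalSubring.ofPrime B (center V B h)).toSubring) :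
    IsSaturatedIn V (LocalSubring.ofPrime B (center V B h)).toSubring where
  le := by
    intro z hz
    obtain ⟨s, t, ht, rfl⟩ := mem_ofPrime_iff.mp hz
    change _ ∈ V
    rw [← V.valuation_le_one_iff, map_div₀, notMem_center_iff.mp ht, div_one]
    exact (V.valuation_le_one_iff _).mpr (h s.2)
  inv_mem := by
    intro z hz hz'
    obtain ⟨s, t, ht, rfl⟩ := mem_ofPrime_iff.mp hz
    by_cases hs0 : (s : K) = 0
    · rw [hs0, zero_div, inv_zero]
      exact zero_mem _
    · refine mem_ofPrime_iff.mpr ⟨t, s, fun hs => ?_, inv_div _ _⟩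
      rw [← V.valuation_le_one_iff, map_inv₀, map_div₀, notMem_center_iff.mp ht, div_one,
        inv_le_one₀ (zero_lt_iff.mpr ((V.valuation.ne_zero_iff).mpr hs0))] at hz'
      exact hz'.not_gt (mem_center_iff.mp hs)
  integral_mem := hB

theorem isSaturatedIn_ofPrime_center {V : ValuationSubring K} {B : Subring K}
    (h : B ≤ V.toSubring) (hB : ∀ z : K, IsIntegral B z → z ∈ B) :
    IsSaturatedIn V (LocalSubring.ofPrime B (center V B h)).toSubring := by
  refine isSaturatedIn_ofPrime_center_of_isIntegral h fun z hz => ?_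
  obtain ⟨m, hm⟩ := IsIntegral.exists_multiple_integral_of_isLocalization
    (center V B h).primeCompl z hz
  refine mem_ofPrime_iff.mpr ⟨⟨_, hB _ hm⟩, m, m.2, ?_⟩
  rw [eq_div_iff (coe_ne_zero_of_notMem m.2), mul_comm]
  rfl

theorem IsSaturatedIn.ofPrime_le {V : ValuationSubring K} {B C : Subring K}
    (hC : IsSaturatedIn V C) (hBC : B ≤ C) {P : Ideal B} [P.IsPrime]
    (h : (LocalSubring.ofPrime B P).toSubring ≤ V.toSubring) :
    (LocalSubring.ofPrime B P).toSubring ≤ C := by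
  intro z hz
  obtain ⟨s, t, ht, rfl⟩ := mem_ofPrime_iff.mp hz
  rw [div_eq_mul_inv]
  exact mul_mem (hBC s.2) (hC.inv_mem _ (hBC t.2) (h (mem_ofPrime_iff.mpr ⟨1, t, ht, by simp⟩)))

end Saturated

/-! ### Rees valuation rings -/

section Rees

variable {A K : Type*} [CommRing A] [Field K] [Algebra A K]

theorem blowupChart_le_normalizedBlowupChart (J : Ideal A) (a : A) :
    blowupChart A K J a ≤ normalizedBlowupChart A K J a := fun z hz =>
  (integralClosure (blowupChart A K J a) K).algebraMap_mem ⟨z, hz⟩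

theorem mem_normalizedBlowupChart_of_isIntegral {J : Ideal A} {a : A} {z : K}
    (hz : IsIntegral (normalizedBlowupChart A K J a) z) : z ∈ normalizedBlowupChart A K J a :=
  isIntegral_trans (R := blowupChart A K J a) z
    (show IsIntegral (integralClosure (blowupChart A K J a) K) z from hz)

theorem normalizedBlowupChart_le {J : Ideal A} {a : A} {C : Subring K}
    (hC : ∀ z : K, IsIntegral C z → z ∈ C) (h : blowupChart A K J a ≤ C) :
    normalizedBlowupChart A K J a ≤ C := fun z hz =>
  hC z (isIntegral_mono h (show IsIntegral (blowupChart A K J a) z from hz))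

theorem inv_mem_ofPrime_iff {B : Subring K} {P : Ideal B} [P.IsPrime] {z : B} (hz : z ≠ 0) :
    (z : K)⁻¹ ∈ (LocalSubring.ofPrime B P).toSubring ↔ z ∉ P := by
  refine ⟨fun hinv hzP => ?_, fun hzP => mem_ofPrime_iff.mpr ⟨1, z, hzP, by simp⟩⟩
  obtain ⟨s, t, ht, hst⟩ := mem_ofPrime_iff.mp hinv
  have hz0 : (z : K) ≠ 0 := fun hz0 => hz (Subtype.ext hz0)
  have hteq : t = z * s := Subtype.ext <| by
    rw [Subring.coe_mul, inv_eq_iff_eq_inv.mp hst, inv_div,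
      div_mul_cancel₀ _ fun hs0 => inv_ne_zero hz0 (by rw [hst, hs0, zero_div])]
  exact ht (hteq ▸ P.mul_mem_right s hzP)

theorem valuation_lt_one_iff_of_eq_ofPrime {V : ValuationSubring K} {B : Subring K} {P : Ideal B}
    [P.IsPrime] (hV : V.toSubring = (LocalSubring.ofPrime B P).toSubring) {z : B} :
    V.valuation (z : K) < 1 ↔ z ∈ P := by
  rcases eq_or_ne z 0 with rfl | hz
  · simp
  have hpos : 0 < V.valuation (z : K) :=
    zero_lt_iff.mpr (V.valuation.ne_zero_iff.mpr fun hz0 => hz (Subtype.ext hz0))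
  rw [← not_iff_not, ← inv_mem_ofPrime_iff hz, ← hV, not_lt, ← inv_le_one₀ hpos, ← map_inv₀]
  exact V.valuation_le_one_iff _

theorem mem_reesValuationRings_iff [FaithfulSMul A K] {J : Ideal A} {V : ValuationSubring K} :
    V ∈ reesValuationRings A K J ↔ IsDiscreteValuationRing V ∧ ∃ a ∈ J, algebraMap A K a ≠ 0 ∧
      blowupChart A K J a ≤ V.toSubring ∧ V.valuation (algebraMap A K a) < 1 ∧
        ∀ C, IsSaturatedIn V C → blowupChart A K J a ≤ C → C = V.toSubring := by
  have hinj := FaithfulSMul.algebraMap_injective A K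
  constructor
  · rintro ⟨hV, a, haJ, ha0, P, hP, ⟨z, hzP, hza⟩, hVP⟩
    have ha : algebraMap A K a ≠ 0 := (map_ne_zero_iff _ hinj).mpr ha0
    have hchart : blowupChart A K J a ≤ V.toSubring :=
      (blowupChart_le_normalizedBlowupChart J a).trans (hVP ▸ LocalSubring.le_ofPrime _ P)
    refine ⟨hV, a, haJ, ha, hchart,
      hza ▸ (valuation_lt_one_iff_of_eq_ofPrime hVP).mpr hzP, fun C hC hle => ?_⟩
    exact hC.le.antisymm <| hVP.le.trans <|
      hC.ofPrime_le (normalizedBlowupChart_le hC.integral_mem hle) hVP.ge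
  · rintro ⟨hV, a, haJ, ha, hchart, hlt, hsat⟩
    have hBV : normalizedBlowupChart A K J a ≤ V.toSubring :=
      normalizedBlowupChart_le (fun z hz => mem_valuationSubring_of_isIntegral V hz) hchart
    have hle := blowupChart_le_normalizedBlowupChart (K := K) J a
    refine ⟨hV, a, haJ, (map_ne_zero_iff _ hinj).mp ha, center V _ hBV, inferInstance,
      ⟨⟨_, hle (algebraMap_mem_blowupChart a)⟩, mem_center_iff.mpr hlt, rfl⟩, ?_⟩
    exact (hsat _ (isSaturatedIn_ofPrime_center hBV
      fun z hz => mem_normalizedBlowupChart_of_isIntegral hz)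
      (hle.trans (LocalSubring.le_ofPrime _ _))).symm

theorem div_mem_iff_valuation_le {V : ValuationSubring K} {b a : K} (ha : a ≠ 0) :
    b / a ∈ V ↔ V.valuation b ≤ V.valuation a := by
  rw [← V.valuation_le_one_iff, map_div₀,
    div_le_one₀ (zero_lt_iff.mpr ((V.valuation.ne_zero_iff).mpr ha))]

theorem exists_blowupChart_le_valuationSubring [FaithfulSMul A K] [IsNoetherianRing A]
    {V : ValuationSubring K} (hA : ∀ r, algebraMap A K r ∈ V) {J : Ideal A} (hJ : J ≠ ⊥) :
    ∃ a ∈ J, algebraMap A K a ≠ 0 ∧ blowupChart A K J a ≤ V.toSubring := by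
  obtain ⟨s, rfl⟩ := J.fg_of_isNoetherianRing
  have hs : s.Nonempty := by
    rw [Finset.nonempty_iff_ne_empty]
    rintro rfl
    exact hJ (by simp)
  obtain ⟨a, ha, hmax⟩ := s.exists_max_image (fun b => V.valuation (algebraMap A K b)) hs
  have hle : ∀ b ∈ Ideal.span (s : Set A),
      V.valuation (algebraMap A K b) ≤ V.valuation (algebraMap A K a) := by
    intro b hb
    induction hb using Submodule.span_induction with
    | mem b hb => exact hmax b hb
    | zero => simp
    | add b c _ _ hb hc => rw [map_add]; exact (V.valuation.map_add _ _).trans (max_le hb hc)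
    | smul r b _ hb =>
      rw [smul_eq_mul, map_mul, map_mul]
      exact (mul_le_of_le_one_left' ((V.valuation_le_one_iff _).mpr (hA r))).trans hb
  have ha0 : algebraMap A K a ≠ 0 := fun ha0 => hJ <| le_bot_iff.mp fun b hb => by
    have hb0 := hle b hb
    rw [ha0, map_zero, le_zero_iff, V.valuation.zero_iff] at hb0
    exact FaithfulSMul.algebraMap_injective A K (hb0.trans (map_zero _).symm)
  exact ⟨a, Ideal.subset_span ha, ha0,
    blowupChart_le hA fun b hb => (div_mem_iff_valuation_le ha0).mpr (hle b hb)⟩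

theorem eq_of_mem_reesValuationRings [FaithfulSMul A K] {J : Ideal A} {V : ValuationSubring K}
    (hV : V ∈ reesValuationRings A K J) {a : A} (haJ : a ∈ J) (ha : algebraMap A K a ≠ 0)
    {C : Subring K} (hC : IsSaturatedIn V C) (hCa : blowupChart A K J a ≤ C) :
    C = V.toSubring := by
  obtain ⟨-, a', haJ', ha', hchart, -, hsat⟩ := mem_reesValuationRings_iff.mp hV
  have hinv : (algebraMap A K a' / algebraMap A K a)⁻¹ ∈ C := by
    refine hC.inv_mem _ (hCa (div_mem_blowupChart haJ')) ?_
    rw [inv_div]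
    exact hchart (div_mem_blowupChart haJ)
  refine hsat C hC (blowupChart_le (fun r => hCa (algebraMap_mem_blowupChart r)) fun b hb => ?_)
  have hdiv : algebraMap A K b / algebraMap A K a' =
      algebraMap A K b / algebraMap A K a * (algebraMap A K a' / algebraMap A K a)⁻¹ := by
    field_simp
  rw [hdiv]
  exact mul_mem (hCa (div_mem_blowupChart hb)) hinv

theorem algebraMap_mem_of_mem_reesValuationRings [FaithfulSMul A K] {J : Ideal A}
    {V : ValuationSubring K} (hV : V ∈ reesValuationRings A K J) (r : A) :
    algebraMap A K r ∈ V := by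
  obtain ⟨-, a, -, -, hchart, -⟩ := mem_reesValuationRings_iff.mp hV
  exact hchart (algebraMap_mem_blowupChart r)

theorem valuation_lt_one_of_mem_reesValuationRings [FaithfulSMul A K] {J : Ideal A}
    {V : ValuationSubring K} (hV : V ∈ reesValuationRings A K J) {b : A} (hb : b ∈ J) :
    V.valuation (algebraMap A K b) < 1 := by
  obtain ⟨-, a, -, ha, hchart, hlt, -⟩ := mem_reesValuationRings_iff.mp hV
  exact ((div_mem_iff_valuation_le ha).mp (hchart (div_mem_blowupChart hb))).trans_lt hlt

theorem mem_reesValuationRings_mul_iff [FaithfulSMul A K] [IsNoetherianRing A]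
    {J₁ J₂ : Ideal A} {V : ValuationSubring K} :
    V ∈ reesValuationRings A K (J₁ * J₂) ↔ IsDiscreteValuationRing V ∧
      ∃ x ∈ J₁, ∃ a ∈ J₂, algebraMap A K x ≠ 0 ∧ algebraMap A K a ≠ 0 ∧
        blowupChart A K J₁ x ≤ V.toSubring ∧ blowupChart A K J₂ a ≤ V.toSubring ∧
          V.valuation (algebraMap A K (x * a)) < 1 ∧ ∀ C, IsSaturatedIn V C →
            blowupChart A K J₁ x ≤ C → blowupChart A K J₂ a ≤ C → C = V.toSubring := by
  constructor
  · intro hV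
    have hA := algebraMap_mem_of_mem_reesValuationRings hV
    have hne : J₁ * J₂ ≠ ⊥ := fun h => by
      obtain ⟨-, d, hd, hd0, -⟩ := mem_reesValuationRings_iff.mp hV
      rw [h, Ideal.mem_bot] at hd
      exact hd0 (hd ▸ map_zero _)
    obtain ⟨x, hx, hx0, hxV⟩ := exists_blowupChart_le_valuationSubring hA (J := J₁)
      fun h => hne (by rw [h, Ideal.bot_mul])
    obtain ⟨a, ha, ha0, haV⟩ := exists_blowupChart_le_valuationSubring hA (J := J₂)
      fun h => hne (by rw [h, Ideal.mul_bot])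
    refine ⟨hV.1, x, hx, a, ha, hx0, ha0, hxV, haV,
      valuation_lt_one_of_mem_reesValuationRings hV (Ideal.mul_mem_mul hx ha),
      fun C hC hxC haC => ?_⟩
    exact eq_of_mem_reesValuationRings hV (Ideal.mul_mem_mul hx ha)
      (by rw [map_mul]; exact mul_ne_zero hx0 ha0) hC
      ((blowupChart_mul_le_iff hx ha hx0 ha0).mpr ⟨hxC, haC⟩)
  · rintro ⟨hdvr, x, hx, a, ha, hx0, ha0, hxV, haV, hlt, hmin⟩
    refine mem_reesValuationRings_iff.mpr ⟨hdvr, x * a, Ideal.mul_mem_mul hx ha,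
      by rw [map_mul]; exact mul_ne_zero hx0 ha0,
      (blowupChart_mul_le_iff hx ha hx0 ha0).mpr ⟨hxV, haV⟩, hlt, fun C hC hle => ?_⟩
    obtain ⟨hxC, haC⟩ := (blowupChart_mul_le_iff hx ha hx0 ha0).mp hle
    exact hmin C hC hxC haC

theorem reesValuationRings_subset_mul [FaithfulSMul A K] [IsNoetherianRing A]
    (J₁ : Ideal A) {J₂ : Ideal A} (hJ₂ : J₂ ≠ ⊥) :
    reesValuationRings A K J₁ ⊆ reesValuationRings A K (J₁ * J₂) := by
  intro V hV
  have hA := algebraMap_mem_of_mem_reesValuationRings hV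
  obtain ⟨hdvr, x, hx, hx0, hxV, hlt, hmin⟩ := mem_reesValuationRings_iff.mp hV
  obtain ⟨a, ha, ha0, haV⟩ := exists_blowupChart_le_valuationSubring hA hJ₂
  refine mem_reesValuationRings_mul_iff.mpr ⟨hdvr, x, hx, a, ha, hx0, ha0, hxV, haV, ?_,
    fun C hC hxC _ => hmin C hC hxC⟩
  rw [map_mul, map_mul]
  exact mul_lt_one_of_lt_of_le hlt ((V.valuation_le_one_iff _).mpr (hA a))

end Rees

/-! ### The order valuation ring -/

section Order

variable {A : Type*} [CommRing A] [IsLocalRing A] {x : A} {n : ℕ}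

theorem natCast_le_order_iff : (n : ℕ∞) ≤ order A x ↔ x ∈ maximalIdeal A ^ n := by
  refine ⟨fun h => ?_, fun h => le_iSup₂_of_le n h le_rfl⟩
  rcases n with _ | n
  · simp
  · have hlt : (n : ℕ∞) < order A x := lt_of_lt_of_le (by exact_mod_cast n.lt_succ_self) h
    simp only [order, lt_iSup_iff] at hlt
    obtain ⟨j, hj, hnj⟩ := hlt
    exact Ideal.pow_le_pow_right (by exact_mod_cast hnj) hj

theorem order_eq_natCast (hx : x ∈ maximalIdeal A ^ n) (hx' : x ∉ maximalIdeal A ^ (n + 1)) :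
    order A x = n := by
  refine le_antisymm (not_lt.mp fun h => hx' ?_) (natCast_le_order_iff.mpr hx)
  exact natCast_le_order_iff.mp (by exact_mod_cast Order.add_one_le_of_lt h)

/-- The order of the ideal `I` is `n`: the largest power of the maximal ideal that contains `I` is
the `n`-th one. -/
structure HasOrder (I : Ideal A) (n : ℕ) : Prop where
  le_pow : I ≤ maximalIdeal A ^ n
  not_le_pow_succ : ¬ I ≤ maximalIdeal A ^ (n + 1)

theorem HasOrder.ne_bot {I : Ideal A} (hI : HasOrder I n) : I ≠ ⊥ :=
  fun h => hI.not_le_pow_succ (h.trans_le bot_le)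

theorem exists_hasOrder [IsNoetherianRing A] {I : Ideal A} (hI : I ≠ ⊥) : ∃ n, HasOrder I n := by
  by_contra! h
  refine hI (le_bot_iff.mp ?_)
  rw [← Ideal.iInf_pow_eq_bot_of_isLocalRing _ (maximalIdeal.isMaximal A).ne_top]
  refine le_iInf fun n => ?_
  induction n with
  | zero => simp
  | succ n ih => exact not_not.mp fun hn => h n ⟨ih, hn⟩

end Order

section Valuation

variable {K : Type*} [Field K] {V W : ValuationSubring K} [IsDiscreteValuationRing V]

theorem ne_top_of_isDiscreteValuationRing : V ≠ ⊤ := by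
  rintro rfl
  obtain ⟨ϖ, hϖ⟩ := IsDiscreteValuationRing.exists_irreducible (⊤ : ValuationSubring K)
  refine hϖ.not_isUnit (IsUnit.of_mul_eq_one ⟨(ϖ : K)⁻¹, trivial⟩ (Subtype.ext ?_))
  exact mul_inv_cancel₀ fun hϖ0 => hϖ.ne_zero (Subtype.ext hϖ0)

theorem eq_of_le_of_isDiscreteValuationRing (h : V ≤ W) (hW : W ≠ ⊤) : V = W := by
  have hne : V.idealOfLE W h ≠ ⊥ := fun hbot => hW <| top_le_iff.mp <| by
    rw [← V.ofPrime_idealOfLE W h, ← V.ofPrime_bot]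
    exact V.ofPrime_le_of_le _ _ hbot.le
  have hmax := eq_maximalIdeal ((V.prime_idealOfLE W h).isMaximal hne)
  refine h.antisymm ?_
  conv_lhs => rw [← V.ofPrime_idealOfLE W h]
  conv_rhs => rw [← V.ofPrime_top]
  exact V.ofPrime_le_of_le _ _ hmax.ge

theorem exists_valuationSubring_toSubring_eq {A : Type*} [CommRing A] [Algebra A K]
    [IsFractionRing A K] {S : Subring K} [ValuationRing S] (hAS : ∀ a, algebraMap A K a ∈ S) :
    ∃ V : ValuationSubring K, V.toSubring = S := by
  have : IsFractionRing S K := .of_field S K fun z => by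
    obtain ⟨a, b, -, rfl⟩ := IsFractionRing.div_surjective (A := A) z
    exact ⟨⟨_, hAS a⟩, ⟨_, hAS b⟩, rfl⟩
  refine ⟨{ S with mem_or_inv_mem' := fun z => ?_ }, rfl⟩
  refine (ValuationRing.isInteger_or_isInteger S z).imp ?_ ?_ <;>
  · rintro ⟨s, hs⟩
    exact hs ▸ s.2

end Valuation

section OrderValuation

variable {R K : Type*} [CommRing R] [IsRegularLocalRing R] [Field K] [Algebra R K] {y : R}

variable (R K y) in
/-- The ideal of the exceptional fibre on the chart of the blow-up of the maximal ideal that belongs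
to `y`. -/
def exceptionalIdeal : Ideal (blowupChart R K (maximalIdeal R) y) :=
  Ideal.span {chartHom R K (maximalIdeal R) y y}

theorem exceptionalIdeal_le_iff {Q : Ideal (blowupChart R K (maximalIdeal R) y)} :
    exceptionalIdeal R K y ≤ Q ↔ chartHom R K (maximalIdeal R) y y ∈ Q :=
  Ideal.span_singleton_le_iff_mem Q

section FaithfulSMul

variable [FaithfulSMul R K]

theorem prime_chartHom (hy : y ∈ maximalIdeal R) (hy2 : y ∉ maximalIdeal R ^ 2) :
    Prime (chartHom R K (maximalIdeal R) y y) := by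
  obtain ⟨d, ⟨e⟩⟩ := exists_quotient_equiv_mvPolynomial (K := K) hy hy2
  refine (Ideal.span_singleton_prime fun hy0 => ?_).mp
    ((Ideal.Quotient.isDomain_iff_prime _).mp (e.toMulEquiv.isDomain _))
  exact algebraMap_ne_zero_of_notMem_sq (K := K) hy2 (congrArg Subtype.val hy0)

theorem isPrime_exceptionalIdeal (hy : y ∈ maximalIdeal R) (hy2 : y ∉ maximalIdeal R ^ 2) :
    (exceptionalIdeal R K y).IsPrime :=
  (Ideal.span_singleton_prime (prime_chartHom hy hy2).ne_zero).mpr (prime_chartHom hy hy2)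

theorem div_pow_mem_ofPrime_chart_iff (hy : y ∈ maximalIdeal R) (hy2 : y ∉ maximalIdeal R ^ 2)
    {Q : Ideal (blowupChart R K (maximalIdeal R) y)} [Q.IsPrime]
    (hQ : chartHom R K (maximalIdeal R) y y ∈ Q) {f : R} {n : ℕ} :
    algebraMap R K f / algebraMap R K y ^ n ∈ (LocalSubring.ofPrime _ Q).toSubring ↔
      f ∈ maximalIdeal R ^ n := by
  refine ⟨fun h => ?_, fun h => LocalSubring.le_ofPrime _ Q (div_pow_mem_blowupChart h)⟩
  obtain ⟨s, t, ht, hst⟩ := mem_ofPrime_iff.mp h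
  rw [div_eq_div_iff (pow_ne_zero n (algebraMap_ne_zero_of_notMem_sq hy2))
    (coe_ne_zero_of_notMem ht)] at hst
  have hts : chartHom R K (maximalIdeal R) y y ^ n * s = t * chartHom R K (maximalIdeal R) y f := by
    apply Subtype.ext
    simp only [Subring.coe_mul, Subring.coe_pow, coe_chartHom]
    rw [mul_comm, ← hst, mul_comm]
  obtain ⟨z, hz⟩ := (prime_chartHom hy hy2).pow_dvd_of_dvd_mul_left n
    (fun hdvd => ht (Ideal.mem_of_dvd _ hdvd hQ)) (Dvd.intro _ hts)
  exact mem_maximalIdeal_pow_of_eq_pow_mul hy hy2 z.2 (congrArg Subtype.val hz)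

variable [(exceptionalIdeal R K y).IsPrime]

theorem pow_div_mem_ofPrime_exceptionalIdeal (hy : y ∈ maximalIdeal R)
    (hy2 : y ∉ maximalIdeal R ^ 2) {g : R} {n : ℕ} (hg : g ∈ maximalIdeal R ^ n)
    (hg' : g ∉ maximalIdeal R ^ (n + 1)) :
    algebraMap R K y ^ n / algebraMap R K g ∈
      (LocalSubring.ofPrime _ (exceptionalIdeal R K y)).toSubring := by
  have hy0 : algebraMap R K y ≠ 0 := algebraMap_ne_zero_of_notMem_sq hy2
  refine mem_ofPrime_iff.mpr ⟨1, ⟨_, div_pow_mem_blowupChart hg⟩, fun hmem => hg' ?_, by simp⟩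
  obtain ⟨z, hz⟩ := Ideal.mem_span_singleton.mp hmem
  have hgz : algebraMap R K g / algebraMap R K y ^ n = algebraMap R K y * z :=
    congrArg Subtype.val hz
  refine mem_maximalIdeal_pow_of_eq_pow_mul hy hy2 z.2 ?_
  rw [(div_eq_iff (pow_ne_zero n hy0)).mp hgz]
  ring

theorem isDiscreteValuationRing_ofPrime_exceptionalIdeal (hy : y ∈ maximalIdeal R)
    (hy2 : y ∉ maximalIdeal R ^ 2) :
    IsDiscreteValuationRing (LocalSubring.ofPrime _ (exceptionalIdeal R K y)).toSubring := by
  set S := (LocalSubring.ofPrime _ (exceptionalIdeal R K y)).toSubring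
  have : IsNoetherianRing S := isNoetherianRing_ofPrime_chart hy hy2 _
  have hprime : Prime (⟨algebraMap R K y, LocalSubring.le_ofPrime _ _
      (algebraMap_mem_blowupChart y)⟩ : S) :=
    prime_ofPrime_chart hy hy2 _ (exceptionalIdeal_le_iff.mp le_rfl) rfl
  have hprincipal : (maximalIdeal S).IsPrincipal := by
    rw [← IsLocalization.AtPrime.map_eq_maximalIdeal (exceptionalIdeal R K y) S]
    exact ⟨_, (Ideal.map_span (algebraMap _ S) {chartHom R K (maximalIdeal R) y y}).trans
      (congrArg Ideal.span Set.image_singleton)⟩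
  have hfield : ¬ IsField S := fun hS =>
    hprime.not_isUnit (letI := hS.toField; IsUnit.mk0 _ hprime.ne_zero)
  exact ((IsDiscreteValuationRing.TFAE S hfield).out 0 4).mpr hprincipal

end FaithfulSMul

variable [IsFractionRing R K]

theorem isOrderValuationRing_of_eq_ofPrime (hy : y ∈ maximalIdeal R)
    (hy2 : y ∉ maximalIdeal R ^ 2) [(exceptionalIdeal R K y).IsPrime] {W : ValuationSubring K}
    (hW : W.toSubring = (LocalSubring.ofPrime _ (exceptionalIdeal R K y)).toSubring) :
    IsOrderValuationRing R K W := by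
  intro f g hg
  have hg0 : algebraMap R K g ≠ 0 := (map_ne_zero_iff _ (IsFractionRing.injective R K)).mpr hg
  have hy0 : algebraMap R K y ≠ 0 := algebraMap_ne_zero_of_notMem_sq hy2
  obtain ⟨n, hn, hn'⟩ := exists_hasOrder (I := Ideal.span {g})
    (mt Ideal.span_singleton_eq_bot.mp hg)
  rw [Ideal.span_singleton_le_iff_mem] at hn hn'
  have hmem {z : K} : z ∈ W ↔
      z ∈ (LocalSubring.ofPrime _ (exceptionalIdeal R K y)).toSubring := hW ▸ Iff.rfl
  have hiff {k : R} {j : ℕ} : algebraMap R K k / algebraMap R K y ^ j ∈ W ↔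
      k ∈ maximalIdeal R ^ j :=
    hmem.trans (div_pow_mem_ofPrime_chart_iff hy hy2 (exceptionalIdeal_le_iff.mp le_rfl))
  rw [order_eq_natCast hn hn', natCast_le_order_iff, ← hiff]
  constructor <;> intro h
  · rw [← div_mul_div_cancel₀ hg0]
    exact mul_mem h (hiff.mpr hn)
  · rw [← div_mul_div_cancel₀ (pow_ne_zero n hy0)]
    exact mul_mem h (hmem.mpr (pow_div_mem_ofPrime_exceptionalIdeal hy hy2 hn hn'))

theorem exists_isOrderValuationRing_eq_ofPrime (hy : y ∈ maximalIdeal R)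
    (hy2 : y ∉ maximalIdeal R ^ 2) [(exceptionalIdeal R K y).IsPrime] :
    ∃ W : ValuationSubring K, IsOrderValuationRing R K W ∧ IsDiscreteValuationRing W ∧
      W.toSubring = (LocalSubring.ofPrime _ (exceptionalIdeal R K y)).toSubring := by
  have hdvr := isDiscreteValuationRing_ofPrime_exceptionalIdeal (K := K) hy hy2
  obtain ⟨W, hW⟩ := exists_valuationSubring_toSubring_eq (A := R)
    fun r => LocalSubring.le_ofPrime _ (exceptionalIdeal R K y) (algebraMap_mem_blowupChart r)
  refine ⟨W, isOrderValuationRing_of_eq_ofPrime hy hy2 hW, ?_, hW⟩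
  change IsDiscreteValuationRing W.toSubring
  rwa [hW]

variable (K) in
theorem exists_isOrderValuationRing (hR : maximalIdeal R ≠ ⊥) :
    ∃ W : ValuationSubring K, IsOrderValuationRing R K W ∧ IsDiscreteValuationRing W := by
  obtain ⟨y, hy, hy2⟩ := SetLike.not_le_iff_exists.mp (not_maximalIdeal_le_sq hR)
  have := isPrime_exceptionalIdeal (K := K) hy hy2
  obtain ⟨W, hW, hdvr, -⟩ := exists_isOrderValuationRing_eq_ofPrime (K := K) hy hy2
  exact ⟨W, hW, hdvr⟩

variable [IsDomain R] {W : ValuationSubring K}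

theorem IsOrderValuationRing.isDiscreteValuationRing (hW : IsOrderValuationRing R K W)
    (hR : maximalIdeal R ≠ ⊥) : IsDiscreteValuationRing W := by
  obtain ⟨W', hW', hdvr⟩ := exists_isOrderValuationRing K hR
  rwa [hW.unique hW']

theorem IsOrderValuationRing.toSubring_eq (hW : IsOrderValuationRing R K W)
    (hy : y ∈ maximalIdeal R) (hy2 : y ∉ maximalIdeal R ^ 2) [(exceptionalIdeal R K y).IsPrime] :
    W.toSubring = (LocalSubring.ofPrime _ (exceptionalIdeal R K y)).toSubring := by
  obtain ⟨W', hW', -, hW'S⟩ := exists_isOrderValuationRing_eq_ofPrime (K := K) hy hy2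
  rwa [hW.unique hW']

end OrderValuation

/-! ### Transforms and base points -/

theorem two_le_ringKrullDim_of_prime {S : Type*} [CommRing S] [IsDomain S] [IsLocalRing S] {w : S}
    (hw : Prime w) (hne : Ideal.span {w} ≠ maximalIdeal S) : 2 ≤ ringKrullDim S := by
  by_contra! hlt
  have : Ring.KrullDimLE 1 S :=
    Ring.krullDimLE_iff.mpr (ENat.WithBot.lt_add_one_iff.mp
      (one_add_one_eq_two (R := WithBot ℕ∞) ▸ hlt))
  exact hne (eq_maximalIdeal (((Ideal.span_singleton_prime hw.ne_zero).mpr hw).isMaximal_of_ne_bot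
    (mt Ideal.span_singleton_eq_bot.mp hw.ne_zero)))

section Transform

variable {A K : Type*} [CommRing A] [Field K] [Algebra A K] {I : Ideal A} {S : Subring K}

theorem mem_extension {b : A} (hb : b ∈ I) {s : S} (hs : (s : K) = algebraMap A K b) :
    s ∈ extension I S :=
  Ideal.subset_span ⟨b, hb, hs⟩

theorem div_mem_of_mem_extension {C : Subring K} (hS : S ≤ C) {a : K}
    (hI : ∀ b ∈ I, algebraMap A K b / a ∈ C) {s : S} (hs : s ∈ extension I S) :
    (s : K) / a ∈ C := by
  induction hs using Submodule.span_induction with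
  | mem s hs => obtain ⟨b, hb, hsb⟩ := hs; exact hsb ▸ hI b hb
  | zero => simp
  | add s t _ _ hs ht => rw [Subring.coe_add, add_div]; exact add_mem hs ht
  | smul c s _ hs =>
    rw [smul_eq_mul, Subring.coe_mul, mul_div_assoc]
    exact mul_mem (hS c.2) hs

theorem mem_transform_iff_of_isLeast {c s : S}
    (hc : IsLeast {L : Ideal S | L.IsPrincipal ∧ extension I S ≤ L} (Ideal.span {c})) :
    s ∈ transform I S ↔ s * c ∈ extension I S := by
  refine ⟨fun hs => hs c hc, fun hs c' hc' => ?_⟩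
  obtain ⟨u, rfl⟩ := Ideal.span_singleton_le_span_singleton.mp (hc'.unique hc).le
  rw [← mul_assoc]
  exact Ideal.mul_mem_right _ _ hs

end Transform

section ChartTransform

variable {R K : Type*} [CommRing R] [IsRegularLocalRing R] [Field K] [Algebra R K]
  {I : Ideal R} {y : R} {r N : ℕ} {Q : Ideal (blowupChart R K (maximalIdeal R) y)}

variable (K) in
/-- The transform of an ideal `I` of order `r` on the chart of the blow-up of the maximal ideal that
belongs to `y`: the equation `y` of the exceptional fibre is divided out of the extension of `I`
as often as possible, that is `r` times. -/
def chartTransform (I : Ideal R) (y : R) (r : ℕ) : Ideal (blowupChart R K (maximalIdeal R) y) :=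
  Ideal.span {z | ∃ b ∈ I, (z : K) = algebraMap R K b / algebraMap R K y ^ r}

theorem mem_of_chartTransform_le (h : chartTransform K I y r ≤ Q)
    {b : R} (hb : b ∈ I) {z : blowupChart R K (maximalIdeal R) y}
    (hz : (z : K) = algebraMap R K b / algebraMap R K y ^ r) : z ∈ Q :=
  h (Ideal.subset_span ⟨b, hb, hz⟩)

theorem chartHom_mem_of_mem_maximalIdeal (hy0 : algebraMap R K y ≠ 0)
    (hQ : chartHom R K (maximalIdeal R) y y ∈ Q) {a : R} (ha : a ∈ maximalIdeal R) :
    chartHom R K (maximalIdeal R) y a ∈ Q := by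
  have hdvd : chartHom R K (maximalIdeal R) y y ∣ chartHom R K (maximalIdeal R) y a :=
    ⟨⟨_, div_mem_blowupChart ha⟩, Subtype.ext (mul_div_cancel₀ _ hy0).symm⟩
  exact Q.mem_of_dvd hdvd hQ

variable [FaithfulSMul R K] [Q.IsPrime]

theorem isLeast_span_pow (hy : y ∈ maximalIdeal R) (hy2 : y ∉ maximalIdeal R ^ 2)
    (hQ : chartHom R K (maximalIdeal R) y y ∈ Q) (hr : HasOrder I r) (hN : maximalIdeal R ^ N ≤ I)
    {w : (LocalSubring.ofPrime _ Q).toSubring} (hw : (w : K) = algebraMap R K y) :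
    IsLeast {L : Ideal (LocalSubring.ofPrime _ Q).toSubring |
      L.IsPrincipal ∧ extension I (LocalSubring.ofPrime _ Q).toSubring ≤ L}
      (Ideal.span {w ^ r}) := by
  have hy0 : algebraMap R K y ≠ 0 := algebraMap_ne_zero_of_notMem_sq hy2
  refine ⟨⟨⟨_, rfl⟩, Ideal.span_le.mpr ?_⟩, ?_⟩
  · rintro t ⟨b, hb, htb⟩
    refine Ideal.mem_span_singleton.mpr ⟨⟨_, LocalSubring.le_ofPrime _ Q
      (div_pow_mem_blowupChart (hr.le_pow hb))⟩, Subtype.ext ?_⟩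
    rw [Subring.coe_mul, Subring.coe_pow, hw, htb, mul_div_cancel₀ _ (pow_ne_zero r hy0)]
  rintro L ⟨⟨c, rfl⟩, hL⟩
  have hdvd {t} (ht : t ∈ extension I (LocalSubring.ofPrime _ Q).toSubring) : c ∣ t :=
    Ideal.mem_span_singleton.mp (hL ht)
  -- `c` divides a power of the prime element `w`, hence it is associated to a power of `w`
  have hcN : c ∣ w ^ N := hdvd (mem_extension (hN (Ideal.pow_mem_pow hy N)) (by simp [hw]))
  obtain ⟨j, -, hj⟩ := (dvd_prime_pow (prime_ofPrime_chart hy hy2 Q hQ hw) N).mp hcN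
  have hIj : I ≤ maximalIdeal R ^ j := by
    intro b hb
    obtain ⟨t, ht⟩ := hj.symm.dvd.trans (hdvd (mem_extension hb (s := ⟨algebraMap R K b,
      LocalSubring.le_ofPrime _ Q (algebraMap_mem_blowupChart b)⟩) rfl))
    have hbt : algebraMap R K b = algebraMap R K y ^ j * t := by
      rw [← hw]
      exact congrArg Subtype.val ht
    rw [← div_pow_mem_ofPrime_chart_iff hy hy2 hQ, hbt,
      mul_div_cancel_left₀ _ (pow_ne_zero j hy0)]
    exact t.2
  have hjr : j ≤ r := not_lt.mp fun h =>
    hr.not_le_pow_succ (hIj.trans (Ideal.pow_le_pow_right h))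
  exact Ideal.span_singleton_le_span_singleton.mpr (hj.dvd.trans (pow_dvd_pow w hjr))

theorem mem_transform_iff (hy : y ∈ maximalIdeal R) (hy2 : y ∉ maximalIdeal R ^ 2)
    (hQ : chartHom R K (maximalIdeal R) y y ∈ Q) (hr : HasOrder I r) (hN : maximalIdeal R ^ N ≤ I)
    {s w : (LocalSubring.ofPrime _ Q).toSubring} (hw : (w : K) = algebraMap R K y) :
    s ∈ transform I (LocalSubring.ofPrime _ Q).toSubring ↔
      s * w ^ r ∈ extension I (LocalSubring.ofPrime _ Q).toSubring :=
  mem_transform_iff_of_isLeast (isLeast_span_pow hy hy2 hQ hr hN hw)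

theorem pow_notMem_extension_iff (hy : y ∈ maximalIdeal R) (hy2 : y ∉ maximalIdeal R ^ 2)
    (hQ : chartHom R K (maximalIdeal R) y y ∈ Q) (hr : I ≤ maximalIdeal R ^ r)
    {w : (LocalSubring.ofPrime _ Q).toSubring} (hw : (w : K) = algebraMap R K y) :
    w ^ r ∉ extension I (LocalSubring.ofPrime _ Q).toSubring ↔ chartTransform K I y r ≤ Q := by
  have hy0 : algebraMap R K y ≠ 0 := algebraMap_ne_zero_of_notMem_sq hy2
  have hw0 : w ^ r ≠ 0 := pow_ne_zero r (prime_ofPrime_chart hy hy2 Q hQ hw).ne_zero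
  constructor
  · refine fun h => Ideal.span_le.mpr ?_
    rintro z ⟨b, hb, hz⟩
    by_contra hzQ
    have hb' : algebraMap R K b = z * algebraMap R K y ^ r :=
      ((eq_div_iff (pow_ne_zero r hy0)).mp hz).symm
    refine h (?_ : w ^ r ∈ _)
    have hwu : w ^ r = ⟨(z : K)⁻¹, mem_ofPrime_iff.mpr ⟨1, z, hzQ, by simp⟩⟩ *
        ⟨algebraMap R K b, LocalSubring.le_ofPrime _ Q (algebraMap_mem_blowupChart b)⟩ := by
      apply Subtype.ext
      change (w : K) ^ r = (z : K)⁻¹ * algebraMap R K b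
      rw [hw, hb', inv_mul_cancel_left₀ (coe_ne_zero_of_notMem hzQ)]
    rw [hwu]
    exact Ideal.mul_mem_left _ _ (mem_extension hb rfl)
  · intro h hmem
    have hle : extension I (LocalSubring.ofPrime _ Q).toSubring ≤
        Ideal.span {w ^ r} * maximalIdeal (LocalSubring.ofPrime _ Q).toSubring := by
      refine Ideal.span_le.mpr ?_
      rintro t ⟨b, hb, htb⟩
      have hbQ := mem_of_chartTransform_le h hb (z := ⟨_, div_pow_mem_blowupChart (hr hb)⟩) rfl
      refine Ideal.mem_span_singleton_mul.mpr ⟨_, (IsLocalization.AtPrime.to_map_mem_maximal_iff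
        (LocalSubring.ofPrime _ Q).toSubring Q _).mpr hbQ, Subtype.ext ?_⟩
      rw [htb, Subring.coe_mul, Subring.coe_pow, hw]
      exact mul_div_cancel₀ _ (pow_ne_zero r hy0)
    obtain ⟨t, ht, htw⟩ := Ideal.mem_span_singleton_mul.mp (hle hmem)
    have ht1 : t = 1 := mul_left_cancel₀ hw0 (htw.trans (mul_one _).symm)
    exact (maximalIdeal.isMaximal _).ne_top ((Ideal.eq_top_iff_one _).mpr (ht1 ▸ ht))

theorem transform_ne_top_iff (hy : y ∈ maximalIdeal R) (hy2 : y ∉ maximalIdeal R ^ 2)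
    (hQ : chartHom R K (maximalIdeal R) y y ∈ Q) (hr : HasOrder I r)
    (hN : maximalIdeal R ^ N ≤ I) :
    transform I (LocalSubring.ofPrime _ Q).toSubring ≠ ⊤ ↔ chartTransform K I y r ≤ Q := by
  let w : (LocalSubring.ofPrime _ Q).toSubring :=
    ⟨algebraMap R K y, LocalSubring.le_ofPrime _ Q (algebraMap_mem_blowupChart y)⟩
  rw [Ne, Ideal.eq_top_iff_one, mem_transform_iff hy hy2 hQ hr hN (w := w) rfl, one_mul]
  exact pow_notMem_extension_iff hy hy2 hQ hr.le_pow rfl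

theorem isLocalQuadraticTransform_ofPrime (hy : y ∈ maximalIdeal R)
    (hy2 : y ∉ maximalIdeal R ^ 2) (hQ : chartHom R K (maximalIdeal R) y y ∈ Q) :
    IsLocalQuadraticTransform R K (LocalSubring.ofPrime _ Q) := by
  have hy0 : algebraMap R K y ≠ 0 := algebraMap_ne_zero_of_notMem_sq hy2
  refine ⟨⟨?_, ⟨?_⟩⟩, y, hy, fun h => hy0 (h ▸ map_zero _), Q, ‹_›, rfl⟩
  · rintro _ ⟨f, rfl⟩
    exact LocalSubring.le_ofPrime _ Q (algebraMap_mem_blowupChart f)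
  · rintro ⟨_, f, rfl⟩ hu
    by_contra hf
    have hfm : f ∈ maximalIdeal R :=
      (mem_maximalIdeal f).mpr fun hf' => hf (hf'.map (algebraMap R K).rangeRestrict)
    exact (mem_maximalIdeal _).mp ((IsLocalization.AtPrime.to_map_mem_maximal_iff
      (LocalSubring.ofPrime _ Q).toSubring Q _).mpr
        (chartHom_mem_of_mem_maximalIdeal hy0 hQ hfm)) hu

theorem two_le_ringKrullDim_ofPrime_chart (hy : y ∈ maximalIdeal R) (hy2 : y ∉ maximalIdeal R ^ 2)
    (hQ : chartHom R K (maximalIdeal R) y y ∈ Q) (hr : HasOrder I r)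
    (h : chartTransform K I y r ≤ Q) :
    2 ≤ ringKrullDim (LocalSubring.ofPrime _ Q).toSubring := by
  have hy0 : algebraMap R K y ≠ 0 := algebraMap_ne_zero_of_notMem_sq hy2
  refine two_le_ringKrullDim_of_prime (w := ⟨algebraMap R K y, LocalSubring.le_ofPrime _ Q
    (algebraMap_mem_blowupChart y)⟩) (prime_ofPrime_chart hy hy2 Q hQ rfl) fun hmax => ?_
  refine hr.not_le_pow_succ fun b hb => (div_pow_mem_ofPrime_chart_iff hy hy2 hQ).mp ?_
  have hbQ := mem_of_chartTransform_le h hb (z := ⟨_, div_pow_mem_blowupChart (hr.le_pow hb)⟩) rfl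
  rw [← IsLocalization.AtPrime.to_map_mem_maximal_iff (LocalSubring.ofPrime _ Q).toSubring Q,
    ← hmax, Ideal.mem_span_singleton] at hbQ
  obtain ⟨t, ht⟩ := hbQ
  have hbt : algebraMap R K b / algebraMap R K y ^ r = algebraMap R K y * t :=
    congrArg Subtype.val ht
  rw [pow_succ, ← div_div, hbt, mul_div_cancel_left₀ _ hy0]
  exact t.2

theorem ofPrime_mem_firstBasePoints (hy : y ∈ maximalIdeal R) (hy2 : y ∉ maximalIdeal R ^ 2)
    (hQ : chartHom R K (maximalIdeal R) y y ∈ Q) (hr : HasOrder I r) (hN : maximalIdeal R ^ N ≤ I)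
    (h : chartTransform K I y r ≤ Q) : LocalSubring.ofPrime _ Q ∈ firstBasePoints K I :=
  ⟨⟨isLocalQuadraticTransform_ofPrime hy hy2 hQ, isRegularLocalRing_ofPrime_chart hy hy2 Q hQ,
    two_le_ringKrullDim_ofPrime_chart hy hy2 hQ hr h⟩,
    (transform_ne_top_iff hy hy2 hQ hr hN).mpr h⟩

end ChartTransform

theorem IsLocalQuadraticTransform.exists_eq_ofPrime {R K : Type*} [CommRing R] [IsLocalRing R]
    [Field K] [Algebra R K] [FaithfulSMul R K] {S : LocalSubring K}
    (hS : IsLocalQuadraticTransform R K S) :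
    ∃ y ∈ maximalIdeal R, y ∉ maximalIdeal R ^ 2 ∧
      ∃ (Q : Ideal (blowupChart R K (maximalIdeal R) y)) (_ : Q.IsPrime),
        chartHom R K (maximalIdeal R) y y ∈ Q ∧ S = LocalSubring.ofPrime _ Q := by
  obtain ⟨⟨hle, hloc⟩, y, hy, hy0, Q, hQ, rfl⟩ := hS
  have hinj := FaithfulSMul.algebraMap_injective R K
  have hy0' : algebraMap R K y ≠ 0 := (map_ne_zero_iff _ hinj).mpr hy0
  have hinv : (algebraMap R K y)⁻¹ ∉ (LocalSubring.ofPrime _ Q).toSubring := by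
    intro h
    have hu : IsUnit (Subring.inclusion hle ⟨algebraMap R K y, y, rfl⟩) :=
      IsUnit.of_mul_eq_one ⟨_, h⟩ (Subtype.ext (mul_inv_cancel₀ hy0'))
    obtain ⟨⟨_, f, rfl⟩, hf⟩ := (hloc.map_nonunit _ hu).exists_right_inv
    have hyf : algebraMap R K y * algebraMap R K f = 1 := congrArg Subtype.val hf
    rw [← map_mul, ← map_one (algebraMap R K)] at hyf
    exact (mem_maximalIdeal y).mp hy (IsUnit.of_mul_eq_one _ (hinj hyf))
  refine ⟨y, hy, fun hy2 => hinv (LocalSubring.le_ofPrime _ Q ?_), Q, hQ, ?_, rfl⟩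
  · simpa [pow_two, div_mul_cancel_left₀ hy0'] using div_pow_mem_blowupChart (K := K) (a := y) hy2
  · by_contra hyQ
    exact hinv (mem_ofPrime_iff.mpr ⟨1, _, hyQ, by simp⟩)

/-! ### Zariski's main theorem and finiteness of base points -/

theorem zariskisMainProperty_of_forall_isMaximal {A E : Type*} [CommRing A] [CommRing E]
    [Algebra A E] [Algebra.FiniteType A E] (q : Ideal E) [q.IsPrime]
    (h : ∀ p : Ideal E, p.IsPrime → p ≤ q → p.under A = q.under A → p.IsMaximal) :
    Algebra.ZariskisMainProperty A q := by
  have hq : q.IsMaximal := h q ‹_› le_rfl rfl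
  let e := PrimeSpectrum.primesOverOrderIsoFiber A E (q.under A)
  let x : (q.under A).primesOver E := ⟨q, ‹_›, Ideal.over_under q⟩
  have hmin : IsMin x := fun p hp =>
    ((h p.1 p.2.1 hp p.2.2.over.symm).eq_of_le hq.ne_top hp).ge
  have hmax : IsMax x := fun p hp => (hq.eq_of_le p.2.1.ne_top hp).ge
  have : IsNoetherianRing ((q.under A).Fiber E) :=
    Algebra.FiniteType.isNoetherianRing (q.under A).ResidueField _
  have : IsJacobsonRing ((q.under A).Fiber E) :=
    isJacobsonRing_of_finiteType (A := (q.under A).ResidueField)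
  have hopen : IsOpen {e x} := by
    rw [(PrimeSpectrum.isOpen_singleton_tfae_of_isNoetherian_of_isJacobsonRing _).out 0 2 rfl rfl]
    constructor
    · rw [PrimeSpectrum.isClosed_singleton_iff_isMaximal, ← PrimeSpectrum.isMax_iff]
      exact e.isMax_apply.mpr hmax
    · rintro _ z hz rfl
      exact (e.isMin_apply.mpr hmin).eq_of_le ((PrimeSpectrum.le_iff_specializes _ _).mpr hz)
  have : Algebra.QuasiFiniteAt (q.under A).ResidueField (e x).asIdeal :=
    .of_isOpen_singleton _ hopen
  have : Algebra.QuasiFiniteAt A q := .of_quasiFiniteAt_residueField (q.under A) q (e x).asIdeal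
    (congrArg Subtype.val (e.symm_apply_apply x))
  exact .of_finiteType q

theorem isIntegral_of_finite_primeSpectrum {k T : Type*} [Field k] [CommRing T] (f : k →+* T)
    (hf : f.FiniteType) [Finite (PrimeSpectrum T)] : f.IsIntegral := by
  let _ := f.toAlgebra
  have : Algebra.FiniteType k T := hf
  have : Algebra.QuasiFinite k T :=
    Algebra.QuasiFinite.iff_finite_comap_preimage_singleton.mpr fun _ => Set.toFinite _
  have : Module.Finite k T := .of_quasiFinite
  exact algebraMap_isIntegral_iff.mpr inferInstance

theorem le_of_ofPrime_eq {K : Type*} [Field K] {D : Subring K} {P Q : Ideal D} [P.IsPrime]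
    [Q.IsPrime] (h : LocalSubring.ofPrime D P = LocalSubring.ofPrime D Q) : P ≤ Q := by
  intro z hz
  by_contra hzQ
  have hz0 : z ≠ 0 := fun h0 => hzQ (h0 ▸ zero_mem Q)
  exact (inv_mem_ofPrime_iff hz0).mp (h ▸ (inv_mem_ofPrime_iff hz0).mpr hzQ) hz

section FiniteBasePoints

variable {R K : Type*} [CommRing R] [IsRegularLocalRing R] [Field K] [Algebra R K]
  [FaithfulSMul R K] {y : R}

theorem finiteType_chartHom (hy : y ∈ maximalIdeal R) (hy2 : y ∉ maximalIdeal R ^ 2) :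
    (chartHom R K (maximalIdeal R) y).FiniteType := by
  obtain ⟨d, x, hx, rfl⟩ := exists_isRegularSystemOfParameters_zero_eq hy hy2
  have hcomp : chartHom R K (maximalIdeal R) (x 0) =
      (chartPresentation K x hx.span_range).comp MvPolynomial.C := by
    ext r
    simp [coe_chartPresentation]
  rw [hcomp]
  refine RingHom.FiniteType.comp (.of_surjective _
    (chartPresentation_surjective x hx.span_range (algebraMap_ne_zero_of_notMem_sq hy2))) ?_
  rw [← MvPolynomial.algebraMap_eq, RingHom.finiteType_algebraMap]
  infer_instance

variable {I : Ideal R} {r N : ℕ} {Q : Ideal (blowupChart R K (maximalIdeal R) y)}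

theorem finite_primeSpectrum_quotient_of_finite_firstBasePoints
    (hfin : (firstBasePoints K I).Finite) (hy : y ∈ maximalIdeal R) (hy2 : y ∉ maximalIdeal R ^ 2)
    (hr : HasOrder I r) (hN : maximalIdeal R ^ N ≤ I)
    (hQ : chartHom R K (maximalIdeal R) y y ∈ Q) (h : chartTransform K I y r ≤ Q) :
    Finite (PrimeSpectrum (blowupChart R K (maximalIdeal R) y ⧸ Q)) := by
  have hmem (p : PrimeSpectrum (blowupChart R K (maximalIdeal R) y ⧸ Q)) :
      LocalSubring.ofPrime _ (p.asIdeal.comap (Ideal.Quotient.mk Q)) ∈ firstBasePoints K I := by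
    have hle : Q ≤ p.asIdeal.comap (Ideal.Quotient.mk Q) :=
      Ideal.mk_ker.symm.trans_le (Ideal.ker_le_comap _)
    exact ofPrime_mem_firstBasePoints hy hy2 (hle hQ) hr hN (h.trans hle)
  have := hfin.to_subtype
  refine Finite.of_injective (fun p => (⟨_, hmem p⟩ : firstBasePoints K I)) fun p p' hpp => ?_
  have heq := congrArg Subtype.val hpp
  exact PrimeSpectrum.ext (Ideal.comap_injective_of_surjective _ Ideal.Quotient.mk_surjective
    (le_antisymm (le_of_ofPrime_eq heq) (le_of_ofPrime_eq heq.symm)))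

theorem isIntegral_quotient_of_finite_firstBasePoints
    (hfin : (firstBasePoints K I).Finite) (hy : y ∈ maximalIdeal R) (hy2 : y ∉ maximalIdeal R ^ 2)
    (hr : HasOrder I r) (hN : maximalIdeal R ^ N ≤ I)
    (hQ : chartHom R K (maximalIdeal R) y y ∈ Q) (h : chartTransform K I y r ≤ Q) :
    ((Ideal.Quotient.mk Q).comp (chartHom R K (maximalIdeal R) y)).IsIntegral := by
  set f := (Ideal.Quotient.mk Q).comp (chartHom R K (maximalIdeal R) y)
  have hker : ∀ a ∈ maximalIdeal R, f a = 0 := fun a ha => Ideal.Quotient.eq_zero_iff_mem.mpr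
    (chartHom_mem_of_mem_maximalIdeal (algebraMap_ne_zero_of_notMem_sq hy2) hQ ha)
  let g : ResidueField R →+* _ := Ideal.Quotient.lift (maximalIdeal R) f hker
  have hg : g.comp (residue R) = f := RingHom.ext fun a =>
    Ideal.Quotient.lift_mk (maximalIdeal R) f hker
  have hft : g.FiniteType := by
    refine RingHom.FiniteType.of_comp_finiteType (f := residue R) ?_
    rw [hg]
    exact (finiteType_chartHom hy hy2).comp_surjective Ideal.Quotient.mk_surjective
  have := finite_primeSpectrum_quotient_of_finite_firstBasePoints hfin hy hy2 hr hN hQ h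
  rw [← hg]
  exact (RingHom.isIntegral_of_surjective _ residue_surjective).trans _ _
    (isIntegral_of_finite_primeSpectrum g hft)

end FiniteBasePoints

/-! ### Extensions of saturated subrings -/

section Extensions

variable {K : Type*} [Field K] {V : ValuationSubring K} {A : Subring K}

theorem IsSaturatedIn.inv_mem_of_valuation_eq_one (hA : IsSaturatedIn V A) {z : K} (hz : z ∈ A)
    (hz1 : V.valuation z = 1) : z⁻¹ ∈ A :=
  hA.inv_mem z hz ((V.valuation_le_one_iff _).mp (by rw [map_inv₀, hz1, inv_one]))

theorem IsSaturatedIn.isMaximal_center (hA : IsSaturatedIn V A) :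
    (center V A hA.le).IsMaximal := by
  refine Ideal.isMaximal_iff.mpr ⟨(Ideal.ne_top_iff_one _).mp Ideal.IsPrime.ne_top',
    fun J z _ hz hzJ => (Ideal.eq_top_iff_one J).mp (J.eq_top_of_isUnit_mem hzJ ?_)⟩
  have hz1 := notMem_center_iff.mp hz
  have hz0 : (z : K) ≠ 0 := (V.valuation.ne_zero_iff).mp (hz1 ▸ one_ne_zero)
  exact .of_mul_eq_one ⟨_, hA.inv_mem_of_valuation_eq_one z.2 hz1⟩
    (Subtype.ext (mul_inv_cancel₀ hz0))

theorem IsSaturatedIn.zariskisMainProperty_center (hA : IsSaturatedIn V A) {E : Subalgebra A K}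
    [Algebra.FiniteType A E] (hE : E.toSubring ≤ V.toSubring)
    (h : ∀ p : Ideal E, p.IsPrime → p ≤ center V E.toSubring hE →
      center V A hA.le ≤ p.under A → Algebra.IsIntegral A (E ⧸ p)) :
    Algebra.ZariskisMainProperty A (S := E) (center V E.toSubring hE) := by
  let q : Ideal E := center V E.toSubring hE
  have : q.IsPrime := inferInstanceAs (center V E.toSubring hE).IsPrime
  have hunder : q.under A = center V A hA.le := Ideal.ext fun t =>
    (mem_center_iff (h := hE) (b := algebraMap A E t)).trans mem_center_iff.symm
  refine zariskisMainProperty_of_forall_isMaximal q fun p hp hpq hpA => ?_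
  have := h p hp hpq (hunder ▸ hpA).ge
  have := hA.isMaximal_center
  have hbot : ((⊥ : Ideal (E ⧸ p)).comap (algebraMap A (E ⧸ p))).IsMaximal := by
    rwa [IsScalarTower.algebraMap_eq A E (E ⧸ p), ← Ideal.comap_comap, ← RingHom.ker_eq_comap_bot,
      Ideal.Quotient.algebraMap_eq, Ideal.mk_ker, ← Ideal.under_def, hpA, hunder]
  exact Ideal.Quotient.maximal_of_isField _ (Ring.isField_iff_maximal_bot.mpr
    (Ideal.isMaximal_of_isIntegral_of_isMaximal_comap _ hbot))

theorem IsSaturatedIn.toSubring_le_of_forall_isIntegral_quotient (hA : IsSaturatedIn V A)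
    {E : Subalgebra A K} [Algebra.FiniteType A E] (hE : E.toSubring ≤ V.toSubring)
    (h : ∀ p : Ideal E, p.IsPrime → p ≤ center V E.toSubring hE →
      center V A hA.le ≤ p.under A → Algebra.IsIntegral A (E ⧸ p)) : E.toSubring ≤ A := by
  obtain ⟨f, hfq, hf, hfx⟩ :=
    Algebra.zariskisMainProperty_iff.mp (hA.zariskisMainProperty_center hE h)
  have hmemA : ∀ z : E, IsIntegral A z → (z : K) ∈ A := fun z hz =>
    hA.integral_mem _ (hz.map E.val)
  have hf1 : V.valuation (f : K) = 1 := notMem_center_iff.mp hfq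
  have hf0 : (f : K) ≠ 0 := (V.valuation.ne_zero_iff).mp (hf1 ▸ one_ne_zero)
  intro z hz
  obtain ⟨m, hm⟩ := hfx ⟨z, hz⟩
  have hz' : z = (f : K)⁻¹ ^ m * ((f : K) ^ m * z) := by
    rw [← mul_assoc, ← mul_pow, inv_mul_cancel₀ hf0, one_pow, one_mul]
  rw [hz']
  exact mul_mem (pow_mem (hA.inv_mem_of_valuation_eq_one (hmemA f hf) hf1) m) (hmemA _ hm)

theorem isIntegral_algHom_of_isIntegral_sup {D : Subring K} {E : Subalgebra A K}
    (hD : D ≤ E.toSubring) {T : Type*} [CommRing T] [Algebra A T] (φ : E →ₐ[A] T)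
    (h : ∀ z : E, (z : K) ∈ D → IsIntegral A (φ z)) {b : E} (hb : IsIntegral ↥(A ⊔ D) (b : K)) :
    IsIntegral A (φ b) := by
  have hle : A ⊔ D ≤ E.toSubring := sup_le (fun z hz => E.algebraMap_mem ⟨z, hz⟩) hD
  let _ : Algebra ↥(A ⊔ D) E := (Subring.inclusion hle).toAlgebra
  have : IsScalarTower ↥(A ⊔ D) E K := .of_algebraMap_eq fun _ => rfl
  have hφ : A ⊔ D ≤ (((integralClosure A T).comap φ).map E.val).toSubring :=
    sup_le (fun z hz => (((integralClosure A T).comap φ).map E.val).algebraMap_mem ⟨z, hz⟩)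
      fun z hz => ⟨⟨z, hD hz⟩, h ⟨z, hD hz⟩ hz, rfl⟩
  let g : ↥(A ⊔ D) →+* integralClosure A T :=
    ((φ : E →+* T).comp (Subring.inclusion hle)).codRestrict (integralClosure A T) fun z => by
      obtain ⟨w, hw, hwz⟩ := hφ z.2
      have hzw : Subring.inclusion hle z = w := Subtype.ext hwz.symm
      rw [RingHom.comp_apply, hzw]
      exact hw
  have hbE : IsIntegral ↥(A ⊔ D) b :=
    (isIntegral_algebraMap_iff (B := K) Subtype.val_injective).mp hb
  exact isIntegral_trans (R := A) _
    (hbE.map_of_comp_eq g (φ : E →+* T) rfl)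

theorem adjoin_toSubring_le {C : Subring K} (hA : A ≤ C) {s : Set K} (hs : s ⊆ C) :
    (Algebra.adjoin A s).toSubring ≤ C :=
  Algebra.adjoin_le (S := { C with algebraMap_mem' := fun a => hA a.2 }) hs

theorem isIntegral_of_forall_isIntegral_adjoin {s : Set K} {T : Type*} [CommRing T] [Algebra A T]
    {φ : Algebra.adjoin A s →ₐ[A] T} (hφ : Function.Surjective φ)
    (h : ∀ z : Algebra.adjoin A s, (z : K) ∈ s → IsIntegral A (φ z)) : Algebra.IsIntegral A T := by
  refine ⟨fun t => ?_⟩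
  obtain ⟨z, rfl⟩ := hφ t
  have htop : ⊤ ≤ (integralClosure A T).comap φ := by
    rw [← Algebra.adjoin_adjoin_coe_preimage]
    exact Algebra.adjoin_le h
  exact htop Algebra.mem_top

end Extensions

theorem exists_finite_blowupChart_le {A K : Type*} [CommRing A] [IsNoetherianRing A] [Field K]
    [Algebra A K] (J : Ideal A) (a : A) :
    ∃ s : Set K, s.Finite ∧ s ⊆ blowupChart A K J a ∧
      ∀ C : Subring K, (∀ r, algebraMap A K r ∈ C) → s ⊆ C → blowupChart A K J a ≤ C := by
  obtain ⟨t, rfl⟩ := J.fg_of_isNoetherianRing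
  refine ⟨(fun b => algebraMap A K b / algebraMap A K a) '' t, t.finite_toSet.image _, ?_, ?_⟩
  · rintro _ ⟨b, hb, rfl⟩
    exact div_mem_blowupChart (Ideal.subset_span hb)
  · intro C hC hs
    refine blowupChart_le hC fun b hb => ?_
    induction hb using Submodule.span_induction with
    | mem b hb => exact hs (Set.mem_image_of_mem _ hb)
    | zero => rw [map_zero, zero_div]; exact zero_mem _
    | add b c _ _ hb hc => rw [map_add, add_div]; exact add_mem hb hc
    | smul r b _ hb =>
      rw [smul_eq_mul, map_mul, mul_div_assoc]
      exact mul_mem (hC r) hb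

theorem exists_isIntegral_valuation_eq_one {K : Type*} [Field K] {V W : ValuationSubring K}
    [IsDiscreteValuationRing V] (hVW : V ≠ W) (hW : W ≠ ⊤) {T : Subring K} (hT : T ≤ V.toSubring)
    (hmin : ∀ C, IsSaturatedIn V C → T ≤ C → C = V.toSubring) :
    ∃ b : K, IsIntegral T b ∧ V.valuation b = 1 ∧ (T ≤ W.toSubring → W.valuation b < 1) := by
  by_contra! h
  have hTW : T ≤ W.toSubring := (h 1 isIntegral_one (map_one _)).1
  let B := (integralClosure T K).toSubring
  have hB : ∀ {V' : ValuationSubring K}, T ≤ V'.toSubring → B ≤ V'.toSubring := fun hV' z hz =>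
    mem_valuationSubring_of_isIntegral _ (isIntegral_mono hV' (show IsIntegral T z from hz))
  have hBint : ∀ z : K, IsIntegral B z → z ∈ B := fun z hz =>
    isIntegral_trans (R := T) z (show IsIntegral (integralClosure T K) z from hz)
  have hTB : T ≤ B := fun z hz => (integralClosure T K).algebraMap_mem ⟨z, hz⟩
  have hCV := hmin _ (isSaturatedIn_ofPrime_center (hB hT) hBint)
    (hTB.trans (LocalSubring.le_ofPrime _ _))
  refine hVW (eq_of_le_of_isDiscreteValuationRing (fun z hz => ?_) hW)
  obtain ⟨s, t, ht, rfl⟩ := mem_ofPrime_iff.mp (hCV.ge hz)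
  have ht1 := (h t t.2 (notMem_center_iff.mp ht)).2
  have hs : W.valuation (s : K) ≤ 1 := (W.valuation_le_one_iff _).mpr (hB hTW s.2)
  rw [← W.valuation_le_one_iff, map_div₀]
  exact div_le_one_of_le₀ (hs.trans ht1) zero_le

/-! ### The charts at the center of a Rees valuation ring -/

section Localization

variable {K : Type*} [Field K] {D E : Subring K} (h : D ≤ E) {q : Ideal E} [q.IsPrime]

theorem inv_mem_ofPrime_comap {z : E} (hzq : z ∉ q)
    (hz : (z : K) ∈ (LocalSubring.ofPrime D (q.comap (Subring.inclusion h))).toSubring) :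
    (z : K)⁻¹ ∈ (LocalSubring.ofPrime D (q.comap (Subring.inclusion h))).toSubring := by
  obtain ⟨d, e, he, hde⟩ := mem_ofPrime_iff.mp hz
  have hmul : Subring.inclusion h d = z * Subring.inclusion h e :=
    Subtype.ext ((div_eq_iff (coe_ne_zero_of_notMem he)).mp hde.symm)
  have hd : d ∉ q.comap (Subring.inclusion h) := by
    rw [Ideal.mem_comap, hmul]
    exact fun hmem => (Ideal.IsPrime.mem_or_mem ‹_› hmem).elim hzq he
  exact mem_ofPrime_iff.mpr ⟨e, d, hd, by rw [hde, inv_div]⟩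

theorem ofPrime_le_ofPrime_comap {B : Subring K} {P : Ideal B} [P.IsPrime]
    (hE : (LocalSubring.ofPrime B P).toSubring ≤ E)
    (hB : B ≤ (LocalSubring.ofPrime D (q.comap (Subring.inclusion h))).toSubring) :
    (LocalSubring.ofPrime B P).toSubring ≤
      (LocalSubring.ofPrime D (q.comap (Subring.inclusion h))).toSubring := by
  intro z hz
  obtain ⟨s, t, ht, rfl⟩ := mem_ofPrime_iff.mp hz
  have htE : (t : K) ∈ E := hE (LocalSubring.le_ofPrime B P t.2)
  have htq : (⟨t, htE⟩ : E) ∉ q := fun htq => by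
    have htE' : (t : K)⁻¹ ∈ E := hE (mem_ofPrime_iff.mpr ⟨1, t, ht, by simp⟩)
    have ht0 : (t : K) ≠ 0 := coe_ne_zero_of_notMem ht
    exact Ideal.IsPrime.ne_top' (I := q) (q.eq_top_of_isUnit_mem htq
      (.of_mul_eq_one ⟨_, htE'⟩ (Subtype.ext (mul_inv_cancel₀ ht0))))
  rw [div_eq_mul_inv]
  exact mul_mem (hB s.2) (inv_mem_ofPrime_comap h htq (hB t.2))

end Localization

theorem isIntegral_quotient_of_isIntegral_comp {R A D E : Type*} [CommRing R] [CommRing A]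
    [CommRing D] [CommRing E] [Algebra A E] {f : R →+* D} {ρ : R →+* A} {i : D →+* E}
    (hi : i.comp f = (algebraMap A E).comp ρ) {q : Ideal E}
    (h : ((Ideal.Quotient.mk (q.comap i)).comp f).IsIntegral) (z : D) :
    IsIntegral A (Ideal.Quotient.mk q (i z)) := by
  let g : D ⧸ q.comap i →+* E ⧸ q := Ideal.quotientMap q i le_rfl
  have hg : (algebraMap A (E ⧸ q)).comp ρ = g.comp ((Ideal.Quotient.mk (q.comap i)).comp f) :=
    RingHom.ext fun x => congrArg (Ideal.Quotient.mk q) (RingHom.congr_fun hi x).symm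
  obtain ⟨p, hp, hpz⟩ := h (Ideal.Quotient.mk _ z)
  refine ⟨p.map ρ, hp.map ρ, ?_⟩
  have hz : Ideal.Quotient.mk q (i z) = g (Ideal.Quotient.mk _ z) := rfl
  rw [Polynomial.eval₂_map, hg, hz, ← Polynomial.hom_eval₂, hpz, map_zero]

section Chart

variable {R K : Type*} [CommRing R] [IsRegularLocalRing R] [Field K] [Algebra R K]
  [IsFractionRing R K] {y a : R} {I : Ideal R} {r N : ℕ}
  {Q : Ideal (blowupChart R K (maximalIdeal R) y)} [Q.IsPrime] {V W : ValuationSubring K}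

theorem mem_ofPrime_of_isIntegral (hy : y ∈ maximalIdeal R) (hy2 : y ∉ maximalIdeal R ^ 2)
    (hQ : chartHom R K (maximalIdeal R) y y ∈ Q) {z : K}
    (hz : IsIntegral (LocalSubring.ofPrime _ Q).toSubring z) :
    z ∈ (LocalSubring.ofPrime _ Q).toSubring := by
  have := isIntegrallyClosed_ofPrime_chart hy hy2 Q hQ
  have : IsFractionRing (LocalSubring.ofPrime _ Q).toSubring K := by
    refine IsFractionRing.of_field _ _ fun z => ?_
    obtain ⟨f, g, -, rfl⟩ := IsFractionRing.div_surjective (A := R) z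
    exact ⟨⟨_, LocalSubring.le_ofPrime _ Q (algebraMap_mem_blowupChart f)⟩,
      ⟨_, LocalSubring.le_ofPrime _ Q (algebraMap_mem_blowupChart g)⟩, rfl⟩
  obtain ⟨w, rfl⟩ := IsIntegrallyClosed.isIntegral_iff.mp hz
  exact w.2

theorem normalizedBlowupChart_le_ofPrime (hy : y ∈ maximalIdeal R) (hy2 : y ∉ maximalIdeal R ^ 2)
    (hQ : chartHom R K (maximalIdeal R) y y ∈ Q) (hI : I ≤ maximalIdeal R ^ r)
    {u : blowupChart R K (maximalIdeal R) y}
    (hu : (u : K) = algebraMap R K a / algebraMap R K y ^ r) (huQ : u ∉ Q) :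
    normalizedBlowupChart R K I a ≤ (LocalSubring.ofPrime _ Q).toSubring := by
  refine normalizedBlowupChart_le (fun z hz => mem_ofPrime_of_isIntegral hy hy2 hQ hz)
    (blowupChart_le (fun f => LocalSubring.le_ofPrime _ Q (algebraMap_mem_blowupChart f))
      fun f hf => ?_)
  refine mem_ofPrime_iff.mpr ⟨⟨_, div_pow_mem_blowupChart (hI hf)⟩, u, huQ, ?_⟩
  rw [hu, div_div_div_cancel_right₀ (pow_ne_zero r (algebraMap_ne_zero_of_notMem_sq hy2))]

theorem IsOrderValuationRing.ofPrime_chart_le [IsDomain R] (hW : IsOrderValuationRing R K W)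
    (hy : y ∈ maximalIdeal R) (hy2 : y ∉ maximalIdeal R ^ 2)
    (hQ : chartHom R K (maximalIdeal R) y y ∈ Q) :
    (LocalSubring.ofPrime _ Q).toSubring ≤ W.toSubring := by
  have := isPrime_exceptionalIdeal (K := K) hy hy2
  rw [hW.toSubring_eq hy hy2]
  intro z hz
  obtain ⟨s, t, ht, rfl⟩ := mem_ofPrime_iff.mp hz
  exact mem_ofPrime_iff.mpr ⟨s, t, fun h => ht (exceptionalIdeal_le_iff.mpr hQ h), rfl⟩

-- If some `c / y ^ r` with `c ∈ I` lies outside `q`, then so does `a / y ^ r`, as `c / a` is in the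
-- chart of `I`. Hence the local ring of the contraction of `q` contains `b` and `b⁻¹`, but it lies
-- in `W`.
theorem chartTransform_le_comap_of_isIntegral [IsDomain R] (hW : IsOrderValuationRing R K W)
    (hy : y ∈ maximalIdeal R) (hy2 : y ∉ maximalIdeal R ^ 2) (hI : I ≤ maximalIdeal R ^ r)
    (haI : a ∈ I) (ha : algebraMap R K a ≠ 0) {P : Ideal (normalizedBlowupChart R K I a)}
    [P.IsPrime] {E : Subring K} (hAE : (LocalSubring.ofPrime _ P).toSubring ≤ E)
    (hDE : blowupChart R K (maximalIdeal R) y ≤ E) {q : Ideal E} [q.IsPrime]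
    (hyq : chartHom R K (maximalIdeal R) y y ∈ q.comap (Subring.inclusion hDE)) {b : E}
    (hbq : b ∉ q) (hb : IsIntegral
      ↥((LocalSubring.ofPrime _ P).toSubring ⊔ blowupChart R K (maximalIdeal R) y) (b : K))
    (hbW : (LocalSubring.ofPrime _ P).toSubring ⊔ blowupChart R K (maximalIdeal R) y ≤
      W.toSubring → W.valuation (b : K) < 1) :
    chartTransform K I y r ≤ q.comap (Subring.inclusion hDE) := by
  let Q := q.comap (Subring.inclusion hDE)
  have hSW : (LocalSubring.ofPrime _ Q).toSubring ≤ W.toSubring := hW.ofPrime_chart_le hy hy2 hyq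
  refine Ideal.span_le.mpr ?_
  rintro z ⟨c, hc, hz⟩
  by_contra hzQ
  let u : blowupChart R K (maximalIdeal R) y := ⟨_, div_pow_mem_blowupChart (hI haI)⟩
  have hca : algebraMap R K c / algebraMap R K a ∈ E :=
    hAE (LocalSubring.le_ofPrime _ P
      (blowupChart_le_normalizedBlowupChart I a (div_mem_blowupChart hc)))
  have huQ : u ∉ Q := fun hu => by
    have hzu : Subring.inclusion hDE z = ⟨_, hca⟩ * Subring.inclusion hDE u :=
      Subtype.ext (hz.trans (div_mul_div_cancel₀ ha).symm)
    exact hzQ (hzu ▸ q.mul_mem_left ⟨_, hca⟩ hu :)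
  have hle : (LocalSubring.ofPrime _ P).toSubring ⊔ blowupChart R K (maximalIdeal R) y ≤
      (LocalSubring.ofPrime _ Q).toSubring :=
    sup_le (ofPrime_le_ofPrime_comap hDE hAE
      (normalizedBlowupChart_le_ofPrime hy hy2 hyq hI rfl huQ)) (LocalSubring.le_ofPrime _ Q)
  have hbS : (b : K) ∈ (LocalSubring.ofPrime _ Q).toSubring :=
    mem_ofPrime_of_isIntegral hy hy2 hyq (isIntegral_mono hle hb)
  have hb0 : (b : K) ≠ 0 := coe_ne_zero_of_notMem hbq
  have hbW' := (W.valuation_le_one_iff _).mpr (hSW (inv_mem_ofPrime_comap hDE hbq hbS))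
  rw [map_inv₀, inv_le_one₀ (zero_lt_iff.mpr (W.valuation.ne_zero_iff.mpr hb0))] at hbW'
  exact hbW'.not_gt (hbW (hle.trans hSW))

theorem blowupChart_le_ofPrime_center [IsDomain R] [IsDiscreteValuationRing V]
    (hW : IsOrderValuationRing R K W) (hVW : V ≠ W) (hy : y ∈ maximalIdeal R)
    (hy2 : y ∉ maximalIdeal R ^ 2) (hfin : (firstBasePoints K I).Finite) (hr : HasOrder I r)
    (hN : maximalIdeal R ^ N ≤ I) (haI : a ∈ I) (ha : algebraMap R K a ≠ 0)
    (hB : normalizedBlowupChart R K I a ≤ V.toSubring)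
    (hD : blowupChart R K (maximalIdeal R) y ≤ V.toSubring)
    (hyV : V.valuation (algebraMap R K y) < 1)
    (hmin : ∀ C, IsSaturatedIn V C → blowupChart R K (maximalIdeal R) y ≤ C →
      blowupChart R K I a ≤ C → C = V.toSubring) :
    blowupChart R K (maximalIdeal R) y ≤
      (LocalSubring.ofPrime _ (center V (normalizedBlowupChart R K I a) hB)).toSubring := by
  let A := (LocalSubring.ofPrime _ (center V (normalizedBlowupChart R K I a) hB)).toSubring
  have hA : IsSaturatedIn V A :=
    isSaturatedIn_ofPrime_center hB fun z hz => mem_normalizedBlowupChart_of_isIntegral hz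
  have hchartA : blowupChart R K I a ≤ A :=
    (blowupChart_le_normalizedBlowupChart I a).trans (LocalSubring.le_ofPrime _ _)
  have hRA : ∀ f, algebraMap R K f ∈ A := fun f => hchartA (algebraMap_mem_blowupChart f)
  have := hW.isDiscreteValuationRing fun h => hy2 (by simp_all)
  -- Adjoining `b`, a unit of `V` but not of `W`, forces the primes of `E` over the maximal ideal of
  -- `A` and below the center of `V` to contain the transform of `I`.
  obtain ⟨b, hb, hbV, hbW⟩ := exists_isIntegral_valuation_eq_one hVW
    (ne_top_of_isDiscreteValuationRing (V := W)) (sup_le hA.le hD) fun C hC hle =>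
      hmin C hC (le_sup_right.trans hle) (hchartA.trans (le_sup_left.trans hle))
  obtain ⟨s, hsfin, hsD, hs⟩ := exists_finite_blowupChart_le (K := K) (maximalIdeal R) y
  let E := Algebra.adjoin A (insert b s)
  have : Algebra.FiniteType A E :=
    .adjoin_of_finite (hsfin.insert b)
  have hAE : A ≤ E.toSubring := fun z hz => E.algebraMap_mem ⟨z, hz⟩
  have hDE : blowupChart R K (maximalIdeal R) y ≤ E.toSubring :=
    hs _ (fun f => hAE (hRA f)) fun z hz => Algebra.subset_adjoin (Set.mem_insert_of_mem _ hz)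
  have hbE : b ∈ E := Algebra.subset_adjoin (Set.mem_insert _ _)
  have hEV : E.toSubring ≤ V.toSubring := adjoin_toSubring_le hA.le (Set.insert_subset
    ((V.valuation_le_one_iff _).mp hbV.le) fun z hz => hD (hsD hz))
  refine hDE.trans (hA.toSubring_le_of_forall_isIntegral_quotient hEV fun q hq hqV hqA => ?_)
  have hyq : algebraMap A E ⟨_, hRA y⟩ ∈ q := hqA (mem_center_iff.mpr hyV)
  have hbq : ⟨b, hbE⟩ ∉ q := fun hbq => (mem_center_iff.mp (hqV hbq)).ne hbV
  have hbase : chartTransform K I y r ≤ Ideal.comap (Subring.inclusion hDE) q :=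
    chartTransform_le_comap_of_isIntegral (E := E.toSubring) (q := q) (b := ⟨b, hbE⟩) hW hy hy2
      hr.le_pow haI ha hAE hDE hyq hbq hb hbW
  have hint : ∀ z : E, (z : K) ∈ blowupChart R K (maximalIdeal R) y →
      IsIntegral A (Ideal.Quotient.mkₐ A q z) := fun z hz =>
    isIntegral_quotient_of_isIntegral_comp (E := E) (f := chartHom R K (maximalIdeal R) y)
      (ρ := (algebraMap R K).codRestrict A hRA) (i := Subring.inclusion hDE) rfl
      (isIntegral_quotient_of_finite_firstBasePoints hfin hy hy2 hr hN hyq hbase) ⟨z, hz⟩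
  refine isIntegral_of_forall_isIntegral_adjoin (T := E ⧸ q) (Ideal.Quotient.mkₐ_surjective A q) ?_
  rintro z (hz | hz)
  · exact isIntegral_algHom_of_isIntegral_sup (T := E ⧸ q) hDE _ hint (hz ▸ hb)
  · exact hint z (hsD hz)

end Chart

/-! ### Rees valuation rings of the maximal ideal and of the transforms -/

theorem notMem_sq_of_blowupChart_le {A K : Type*} [CommRing A] [Field K] [Algebra A K]
    {V : ValuationSubring K} {J : Ideal A} {a : A} (ha0 : algebraMap A K a ≠ 0)
    (hV : blowupChart A K J a ≤ V.toSubring) (hlt : V.valuation (algebraMap A K a) < 1) :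
    a ∉ J ^ 2 := by
  intro ha2
  have hinv : (algebraMap A K a)⁻¹ ∈ V := by
    have hdiv := hV (div_pow_mem_blowupChart ha2)
    rwa [pow_two, div_mul_cancel_left₀ ha0] at hdiv
  rw [← V.valuation_le_one_iff, map_inv₀,
    inv_le_one₀ (zero_lt_iff.mpr (V.valuation.ne_zero_iff.mpr ha0))] at hinv
  exact hinv.not_gt hlt

section Product

variable {R K : Type*} [CommRing R] [IsRegularLocalRing R] [Field K] [Algebra R K]
  [IsFractionRing R K] {y : R} {V W : ValuationSubring K}

theorem isSaturatedIn_ofPrime_center_chart (hy : y ∈ maximalIdeal R)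
    (hy2 : y ∉ maximalIdeal R ^ 2) (hD : blowupChart R K (maximalIdeal R) y ≤ V.toSubring)
    (hlt : V.valuation (algebraMap R K y) < 1) :
    IsSaturatedIn V (LocalSubring.ofPrime _ (center V _ hD)).toSubring :=
  isSaturatedIn_ofPrime_center_of_isIntegral hD fun _ hz =>
    mem_ofPrime_of_isIntegral hy hy2 (mem_center_iff.mpr hlt) hz

theorem IsOrderValuationRing.eq_of_ofPrime_center_eq [IsDomain R] [IsDiscreteValuationRing V]
    (hW : IsOrderValuationRing R K W) (hy : y ∈ maximalIdeal R) (hy2 : y ∉ maximalIdeal R ^ 2)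
    (hD : blowupChart R K (maximalIdeal R) y ≤ V.toSubring)
    (hlt : V.valuation (algebraMap R K y) < 1)
    (h : (LocalSubring.ofPrime _ (center V _ hD)).toSubring = V.toSubring) : V = W := by
  have := hW.isDiscreteValuationRing fun h => hy2 (by simp_all)
  have hVW : V.toSubring ≤ W.toSubring :=
    h ▸ hW.ofPrime_chart_le hy hy2 (mem_center_iff.mpr hlt)
  exact eq_of_le_of_isDiscreteValuationRing hVW ne_top_of_isDiscreteValuationRing

theorem IsOrderValuationRing.mem_reesValuationRings_maximalIdeal [IsDomain R]
    (hW : IsOrderValuationRing R K W) (hR : maximalIdeal R ≠ ⊥) :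
    W ∈ reesValuationRings R K (maximalIdeal R) := by
  obtain ⟨y, hy, hy2⟩ := SetLike.not_le_iff_exists.mp (not_maximalIdeal_le_sq hR)
  have := isPrime_exceptionalIdeal (K := K) hy hy2
  have hWS := hW.toSubring_eq hy hy2
  refine mem_reesValuationRings_iff.mpr ⟨hW.isDiscreteValuationRing hR, y, hy,
    algebraMap_ne_zero_of_notMem_sq hy2, hWS ▸ LocalSubring.le_ofPrime _ _, ?_,
    fun C hC hle => hC.le.antisymm (hWS ▸ hC.ofPrime_le hle hWS.ge)⟩
  exact (valuation_lt_one_iff_of_eq_ofPrime hWS (z := chartHom R K _ y y)).mpr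
    (exceptionalIdeal_le_iff.mp le_rfl)

theorem IsOrderValuationRing.reesValuationRings_maximalIdeal [IsDomain R]
    (hW : IsOrderValuationRing R K W) (hR : maximalIdeal R ≠ ⊥) :
    reesValuationRings R K (maximalIdeal R) = {W} := by
  refine Set.eq_singleton_iff_unique_mem.mpr
    ⟨hW.mem_reesValuationRings_maximalIdeal hR, fun V hV => ?_⟩
  have hlt {x : R} (hx : x ∈ maximalIdeal R) := valuation_lt_one_of_mem_reesValuationRings hV hx
  obtain ⟨y, hy, hy0, hD⟩ := exists_blowupChart_le_valuationSubring
    (algebraMap_mem_of_mem_reesValuationRings hV) hR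
  have hy2 := notMem_sq_of_blowupChart_le hy0 hD (hlt hy)
  have := hV.1
  exact hW.eq_of_ofPrime_center_eq hy hy2 hD (hlt hy) (eq_of_mem_reesValuationRings hV hy hy0
    (isSaturatedIn_ofPrime_center_chart hy hy2 hD (hlt hy)) (LocalSubring.le_ofPrime _ _))

end Product

section BasePoint

variable {R K : Type*} [CommRing R] [IsRegularLocalRing R] [Field K] [Algebra R K]
  [FaithfulSMul R K] {y a : R} {Q : Ideal (blowupChart R K (maximalIdeal R) y)} [Q.IsPrime]
  {I : Ideal R} {r N : ℕ}

theorem mem_transform_of_eq_div (hy : y ∈ maximalIdeal R) (hy2 : y ∉ maximalIdeal R ^ 2)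
    (hQ : chartHom R K (maximalIdeal R) y y ∈ Q) (hr : HasOrder I r) (hN : maximalIdeal R ^ N ≤ I)
    (ha : a ∈ I) {s : (LocalSubring.ofPrime _ Q).toSubring}
    (hs : (s : K) = algebraMap R K a / algebraMap R K y ^ r) :
    s ∈ transform I (LocalSubring.ofPrime _ Q).toSubring := by
  refine (mem_transform_iff hy hy2 hQ hr hN
    (w := ⟨_, LocalSubring.le_ofPrime _ Q (algebraMap_mem_blowupChart y)⟩) rfl).mpr
    (mem_extension ha ?_)
  rw [Subring.coe_mul, hs]
  exact div_mul_cancel₀ _ (pow_ne_zero r (algebraMap_ne_zero_of_notMem_sq hy2))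

theorem blowupChart_transform_le_iff (hy : y ∈ maximalIdeal R) (hy2 : y ∉ maximalIdeal R ^ 2)
    (hQ : chartHom R K (maximalIdeal R) y y ∈ Q) (hr : HasOrder I r) (hN : maximalIdeal R ^ N ≤ I)
    {s : (LocalSubring.ofPrime _ Q).toSubring}
    (hs : (s : K) = algebraMap R K a / algebraMap R K y ^ r) {C : Subring K} :
    blowupChart _ K (transform I (LocalSubring.ofPrime _ Q).toSubring) s ≤ C ↔
      (LocalSubring.ofPrime _ Q).toSubring ≤ C ∧ blowupChart R K I a ≤ C := by
  let S := (LocalSubring.ofPrime _ Q).toSubring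
  have hDS := LocalSubring.le_ofPrime _ Q
  constructor
  · intro h
    have hSC : S ≤ C := fun z hz => h (algebraMap_mem_blowupChart (⟨z, hz⟩ : S))
    refine ⟨hSC, blowupChart_le (fun f => hSC (hDS (algebraMap_mem_blowupChart f))) fun b hb => ?_⟩
    have hdiv := h (div_mem_blowupChart (mem_transform_of_eq_div hy hy2 hQ hr hN hb
      (s := ⟨_, hDS (div_pow_mem_blowupChart (hr.le_pow hb))⟩) rfl))
    change algebraMap R K b / algebraMap R K y ^ r / (s : K) ∈ C at hdiv
    rwa [hs, div_div_div_cancel_right₀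
      (pow_ne_zero r (algebraMap_ne_zero_of_notMem_sq hy2))] at hdiv
  · rintro ⟨hSC, haC⟩
    refine blowupChart_le (fun t => hSC t.2) fun t ht => ?_
    have hdiv := div_mem_of_mem_extension hSC (fun b hb => haC (div_mem_blowupChart hb))
      ((mem_transform_iff hy hy2 hQ hr hN
        (w := ⟨_, hDS (algebraMap_mem_blowupChart y)⟩) rfl).mp ht)
    change (t : K) / s ∈ C
    rwa [hs, div_div_eq_mul_div]

theorem IsLocalQuadraticTransform.reesValuationRings_transform_subset {S : LocalSubring K}
    (hS : IsLocalQuadraticTransform R K S) (hr : HasOrder I r) (hN : maximalIdeal R ^ N ≤ I) :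
    reesValuationRings S.toSubring K (transform I S.toSubring) ⊆
      reesValuationRings R K (maximalIdeal R * I) := by
  intro V hV
  obtain ⟨y, hy, hy2, Q, hQp, hQ, rfl⟩ := hS.exists_eq_ofPrime
  have hy0 : algebraMap R K y ≠ 0 := algebraMap_ne_zero_of_notMem_sq hy2
  have hDS := LocalSubring.le_ofPrime _ Q
  have hSV : (LocalSubring.ofPrime _ Q).toSubring ≤ V.toSubring := fun z hz =>
    algebraMap_mem_of_mem_reesValuationRings hV ⟨z, hz⟩
  have hRV : ∀ f, algebraMap R K f ∈ V := fun f => hSV (hDS (algebraMap_mem_blowupChart f))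
  obtain ⟨a, ha, ha0, haV⟩ := exists_blowupChart_le_valuationSubring hRV hr.ne_bot
  let s : (LocalSubring.ofPrime _ Q).toSubring :=
    ⟨_, hDS (div_pow_mem_blowupChart (hr.le_pow ha))⟩
  have hsT := mem_transform_of_eq_div hy hy2 hQ hr hN ha (s := s) rfl
  refine mem_reesValuationRings_mul_iff.mpr
    ⟨hV.1, y, hy, a, ha, hy0, ha0, hDS.trans hSV, haV, ?_, fun C hC hDC haC => ?_⟩
  · have hya : algebraMap R K (y * a) = algebraMap _ K s * algebraMap R K (y ^ (r + 1)) := by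
      change _ = algebraMap R K a / algebraMap R K y ^ r * _
      rw [map_mul, map_pow, pow_succ]
      field_simp
    rw [hya, map_mul]
    exact mul_lt_one_of_lt_of_le (valuation_lt_one_of_mem_reesValuationRings hV hsT)
      ((V.valuation_le_one_iff _).mpr (hRV _))
  · exact eq_of_mem_reesValuationRings hV hsT (div_ne_zero ha0 (pow_ne_zero r hy0)) hC
      ((blowupChart_transform_le_iff hy hy2 hQ hr hN rfl).mpr ⟨hC.ofPrime_le hDC hSV, haC⟩)

end BasePoint

section Center

variable {R K : Type*} [CommRing R] [IsRegularLocalRing R] [Field K] [Algebra R K]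
  {y a : R} {I : Ideal R} {r N : ℕ} {V W : ValuationSubring K}

theorem chartTransform_le_center (ha0 : algebraMap R K a ≠ 0)
    (haV : blowupChart R K I a ≤ V.toSubring)
    (hD : blowupChart R K (maximalIdeal R) y ≤ V.toSubring)
    (hlt : V.valuation (algebraMap R K a / algebraMap R K y ^ r) < 1) :
    chartTransform K I y r ≤ center V _ hD := by
  refine Ideal.span_le.mpr ?_
  rintro z ⟨b, hb, hz⟩
  refine mem_center_iff.mpr ?_
  rw [hz, ← div_mul_div_cancel₀ ha0, map_mul]
  exact (mul_le_of_le_one_left' ((V.valuation_le_one_iff _).mpr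
    (haV (div_mem_blowupChart hb)))).trans_lt hlt

variable [IsFractionRing R K]

theorem exists_of_mem_reesValuationRings_maximalIdeal_mul (hN : maximalIdeal R ^ N ≤ I)
    (hV : V ∈ reesValuationRings R K (maximalIdeal R * I)) :
    ∃ y ∈ maximalIdeal R, y ∉ maximalIdeal R ^ 2 ∧ V.valuation (algebraMap R K y) < 1 ∧
      ∃ a ∈ I, algebraMap R K a ≠ 0 ∧ blowupChart R K (maximalIdeal R) y ≤ V.toSubring ∧
        blowupChart R K I a ≤ V.toSubring ∧ ∀ C, IsSaturatedIn V C →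
          blowupChart R K (maximalIdeal R) y ≤ C → blowupChart R K I a ≤ C →
            C = V.toSubring := by
  obtain ⟨-, y, hy, a, ha, hy0, ha0, hD, haV, -, hmin⟩ := mem_reesValuationRings_mul_iff.mp hV
  have hlt : V.valuation (algebraMap R K y) < 1 := by
    have hpow := valuation_lt_one_of_mem_reesValuationRings hV
      (Ideal.mul_mem_mul hy (hN (Ideal.pow_mem_pow hy N)))
    rw [← pow_succ', map_pow, map_pow] at hpow
    exact lt_of_not_ge fun h => hpow.not_ge (one_le_pow_of_one_le' h (N + 1))
  exact ⟨y, hy, notMem_sq_of_blowupChart_le hy0 hD hlt, hlt, a, ha, ha0, hD, haV, hmin⟩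

theorem IsOrderValuationRing.valuation_div_pow_lt_one [IsDomain R] [IsDiscreteValuationRing V]
    (hW : IsOrderValuationRing R K W) (hVW : V ≠ W) (hy : y ∈ maximalIdeal R)
    (hy2 : y ∉ maximalIdeal R ^ 2) (hyV : V.valuation (algebraMap R K y) < 1)
    (hI : I ≤ maximalIdeal R ^ r) (ha : a ∈ I)
    (hD : blowupChart R K (maximalIdeal R) y ≤ V.toSubring)
    (hmin : ∀ C, IsSaturatedIn V C → blowupChart R K (maximalIdeal R) y ≤ C →
      blowupChart R K I a ≤ C → C = V.toSubring) :
    V.valuation (algebraMap R K a / algebraMap R K y ^ r) < 1 := by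
  by_contra hnot
  let u : blowupChart R K (maximalIdeal R) y := ⟨_, div_pow_mem_blowupChart (hI ha)⟩
  have hu : u ∉ center V _ hD := mem_center_iff.not.mpr hnot
  refine hVW (hW.eq_of_ofPrime_center_eq hy hy2 hD hyV (hmin _
    (isSaturatedIn_ofPrime_center_chart hy hy2 hD hyV) (LocalSubring.le_ofPrime _ _) ?_))
  exact (blowupChart_le_normalizedBlowupChart I a).trans
    (normalizedBlowupChart_le_ofPrime hy hy2 (mem_center_iff.mpr hyV) hI rfl hu)

theorem IsOrderValuationRing.mem_reesValuationRings_of_mem_mul [IsDomain R]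
    (hW : IsOrderValuationRing R K W) (hfin : (firstBasePoints K I).Finite) (hr : HasOrder I r)
    (hN : maximalIdeal R ^ N ≤ I) (hV : V ∈ reesValuationRings R K (maximalIdeal R * I))
    (hVW : V ≠ W) : V ∈ reesValuationRings R K I := by
  have := hV.1
  obtain ⟨y, hy, hy2, hyV, a, ha, ha0, hD, haV, hmin⟩ :=
    exists_of_mem_reesValuationRings_maximalIdeal_mul hN hV
  have hult := hW.valuation_div_pow_lt_one hVW hy hy2 hyV hr.le_pow ha hD hmin
  have hB : normalizedBlowupChart R K I a ≤ V.toSubring :=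
    normalizedBlowupChart_le (fun _ hz => mem_valuationSubring_of_isIntegral V hz) haV
  have hBV := isSaturatedIn_ofPrime_center hB
    fun z hz => mem_normalizedBlowupChart_of_isIntegral hz
  refine mem_reesValuationRings_iff.mpr ⟨hV.1, a, ha, ha0, haV, ?_, fun C hC haC => ?_⟩
  · rw [← div_mul_cancel₀ (algebraMap R K a)
      (pow_ne_zero r (algebraMap_ne_zero_of_notMem_sq (K := K) hy2)), map_mul]
    exact mul_lt_one_of_lt_of_le hult
      ((V.valuation_le_one_iff _).mpr (pow_mem (algebraMap_mem_of_mem_reesValuationRings hV y) r))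
  · have hDB := blowupChart_le_ofPrime_center hW hVW hy hy2 hfin hr hN ha ha0 hB hD hyV hmin
    exact hmin C hC (hDB.trans
      (hC.ofPrime_le (normalizedBlowupChart_le hC.integral_mem haC) hBV.le)) haC

theorem IsOrderValuationRing.exists_mem_firstBasePoints_of_mem_mul [IsDomain R]
    (hW : IsOrderValuationRing R K W) (hr : HasOrder I r) (hN : maximalIdeal R ^ N ≤ I)
    (hV : V ∈ reesValuationRings R K (maximalIdeal R * I)) (hVW : V ≠ W) :
    ∃ S ∈ firstBasePoints K I, V ∈ reesValuationRings S.toSubring K (transform I S.toSubring) := by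
  have := hV.1
  obtain ⟨y, hy, hy2, hyV, a, ha, ha0, hD, haV, hmin⟩ :=
    exists_of_mem_reesValuationRings_maximalIdeal_mul hN hV
  have hult := hW.valuation_div_pow_lt_one hVW hy hy2 hyV hr.le_pow ha hD hmin
  have hQ : chartHom R K (maximalIdeal R) y y ∈ center V _ hD := mem_center_iff.mpr hyV
  have hDS := LocalSubring.le_ofPrime _ (center V _ hD)
  have hSV := (isSaturatedIn_ofPrime_center_chart hy hy2 hD hyV).le
  let s : (LocalSubring.ofPrime _ (center V _ hD)).toSubring :=
    ⟨_, hDS (div_pow_mem_blowupChart (hr.le_pow ha))⟩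
  have hs {C : Subring K} := blowupChart_transform_le_iff hy hy2 hQ hr hN (s := s) rfl (C := C)
  refine ⟨_, ofPrime_mem_firstBasePoints hy hy2 hQ hr hN (chartTransform_le_center ha0 haV hD hult),
    mem_reesValuationRings_iff.mpr ⟨hV.1, s, mem_transform_of_eq_div hy hy2 hQ hr hN ha rfl,
      div_ne_zero ha0 (pow_ne_zero r (algebraMap_ne_zero_of_notMem_sq hy2)),
      hs.mpr ⟨hSV, haV⟩, hult, fun C hC hle => ?_⟩⟩
  obtain ⟨hSC, haC⟩ := hs.mp hle
  exact hmin C hC (hDS.trans hSC) haC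

theorem IsOrderValuationRing.reesValuationRings_maximalIdeal_mul [IsDomain R]
    (hW : IsOrderValuationRing R K W) (hR : maximalIdeal R ≠ ⊥)
    (hfin : (firstBasePoints K I).Finite) (hr : HasOrder I r) (hN : maximalIdeal R ^ N ≤ I) :
    reesValuationRings R K (maximalIdeal R * I) = {W} ∪ reesValuationRings R K I := by
  refine Set.Subset.antisymm (fun V hV => ?_) (Set.union_subset ?_ ?_)
  · exact (eq_or_ne V W).imp_right (hW.mem_reesValuationRings_of_mem_mul hfin hr hN hV)
  · exact hW.reesValuationRings_maximalIdeal hR ▸ reesValuationRings_subset_mul _ hr.ne_bot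
  · exact mul_comm I (maximalIdeal R) ▸ reesValuationRings_subset_mul I hR

theorem IsOrderValuationRing.reesValuationRings_maximalIdeal_mul_eq_biUnion [IsDomain R]
    (hW : IsOrderValuationRing R K W) (hR : maximalIdeal R ≠ ⊥) (hr : HasOrder I r)
    (hN : maximalIdeal R ^ N ≤ I) :
    reesValuationRings R K (maximalIdeal R * I) = {W} ∪ ⋃ S ∈ firstBasePoints K I,
      reesValuationRings S.toSubring K (transform I S.toSubring) := by
  refine Set.Subset.antisymm (fun V hV => ?_) (Set.union_subset ?_ (Set.iUnion₂_subset ?_))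
  · exact (eq_or_ne V W).imp_right fun hVW =>
      Set.mem_iUnion₂.mpr (by simpa using hW.exists_mem_firstBasePoints_of_mem_mul hr hN hV hVW)
  · exact hW.reesValuationRings_maximalIdeal hR ▸ reesValuationRings_subset_mul _ hr.ne_bot
  · exact fun S hS => hS.1.1.reesValuationRings_transform_subset hr hN

end Center

end QuadTransform

theorem mainTheorem6 {R K : Type*} [CommRing R] [IsDomain R] [IsRegularLocalRing R] [Field K]
    [Algebra R K] [IsFractionRing R K] (hdim : 2 ≤ ringKrullDim R)
    (I : Ideal R) (hprim : I.IsPrimary) (hrad : I.radical = IsLocalRing.maximalIdeal R)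
    (hfin : (QuadTransform.firstBasePoints K I).Finite) :
    ∃ ordR : ValuationSubring K, QuadTransform.IsOrderValuationRing R K ordR ∧
      {ordR} ∪ QuadTransform.reesValuationRings R K I =
        {ordR} ∪ ⋃ S ∈ QuadTransform.firstBasePoints K I,
          QuadTransform.reesValuationRings S.toSubring K
            (QuadTransform.transform I S.toSubring) ∧
      QuadTransform.reesValuationRings R K (IsLocalRing.maximalIdeal R * I) =
        QuadTransform.reesValuationRings R K (IsLocalRing.maximalIdeal R) ∪
          QuadTransform.reesValuationRings R K I ∧
      QuadTransform.reesValuationRings R K (IsLocalRing.maximalIdeal R) ∪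
          QuadTransform.reesValuationRings R K I =
        {ordR} ∪ QuadTransform.reesValuationRings R K I := by
  have hR : IsLocalRing.maximalIdeal R ≠ ⊥ := fun h => by
    rw [ringKrullDim_eq_zero_of_isField (IsLocalRing.isField_iff_maximalIdeal_eq.mpr h)] at hdim
    exact absurd hdim (by decide)
  have hI : I ≠ ⊥ := by
    rintro rfl
    exact hR (hrad.symm.trans Ideal.isPrime_bot.radical)
  obtain ⟨N, hN⟩ : ∃ N, IsLocalRing.maximalIdeal R ^ N ≤ I :=
    hrad ▸ I.exists_radical_pow_le_of_fg (IsNoetherian.noetherian _)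
  obtain ⟨r, hr⟩ := QuadTransform.exists_hasOrder hI
  obtain ⟨W, hW, -⟩ := QuadTransform.exists_isOrderValuationRing K hR
  have hmul := hW.reesValuationRings_maximalIdeal_mul hR hfin hr hN
  refine ⟨W, hW, ?_, ?_, by rw [hW.reesValuationRings_maximalIdeal hR]⟩
  · rw [← hmul, hW.reesValuationRings_maximalIdeal_mul_eq_biUnion hR hr hN]
  · rw [hmul, hW.reesValuationRings_maximalIdeal hR]
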